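/- Let $R$ be a real closed field. Let $A$ and $B$ be finitely generated commutative $R$-algebras, $X=\operatorname{Spec} B$, $Y=\operatorname{Spec} A$ (not assumed reduced or irreducible), and let $f:X\to Y$ be a morphism over $R$ that is finite, free and dominant; that is, $f$ is induced by a homomorphism of $R$-algebras $A\to B$ making $B$ a free $A$-module of finite rank, and $f(X)$ is dense in $Y$. Let $h\in B$ and $D(h)=\{x\in X : h\notin x\}\cong\operatorname{Spec} B_h$. Write $X(R)$, $Y(R)$ for the sets of $R$-rational points (points with residue field $R$) and $f_0:X(R)\to Y(R)$ for the map induced by $f$. For $y\in Y$ with residue field $\kappa_y$, let $D(h)_{\overline y}=\operatorname{Spec}\left(B_h\otimes_A\overline{\kappa_y}\right)$ be the geometric fiber of $f|_{D(h)}$ over $y$, where $\overline{\kappa_y}$ is an algebraic closure of $\kappa_y$. Choose any closed immersion $Y\hookrightarrow\mathbb A^n_R$ over $R$, and regard $Y(R)$ as a subset of $R^n$ through it. A subset of $R^n$ is semi-algebraic if it is a finite union of sets defined by finitely many polynomial conditions $p=0$ and $q>0$ with coefficients in $R$; a semi-algebraic set is semi-algebraically connected if it is not the disjoint union of two non-empty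 semi-algebraic subsets that are closed in it for the Euclidean topology. Let $S\subseteq Y(R)$ be a semi-algebraically connected semi-algebraic set such that the cardinality $\#D(h)_{\overline y}$ is the same for all $y\in S$. Then the cardinality $\#\left(f_0^{-1}(y)\cap D(h)\right)$ is the same for all $y\in S$. -/

import Mathlib

/-- The set `X(k)` of `k`-rational points of `X = Spec B`, for a `k`-algebra `B`: the points `x`
of `X` whose residue field is `k`. -/
def rationalPoints (k B : Type*) [Field k] [CommRing B] [Algebra k B] :
    Set (PrimeSpectrum B) :=
  {x | Function.Bijective (algebraMap k x.asIdeal.ResidueField)}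

/-- The value `a(y) ∈ k` of a regular function `a ∈ A` at a `k`-rational point `y` of `Spec A`:
the image of `a` in the residue field of `y`, which is identified with `k`. -/
noncomputable def rationalPointEval {k A : Type*} [Field k] [CommRing A] [Algebra k A]
    (y : rationalPoints k A) : A →ₐ[k] k :=
  ((AlgEquiv.ofBijective (Algebra.ofId k y.1.asIdeal.ResidueField) y.2).symm :
      y.1.asIdeal.ResidueField →ₐ[k] k).comp
    (IsScalarTower.toAlgHom k A y.1.asIdeal.ResidueField)

/-- A `k`-morphism `Spec B → Spec A` sends `k`-rational points to `k`-rational points. -/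
theorem mapsTo_rationalPoints (k A B : Type*) [Field k] [CommRing A] [CommRing B] [Algebra k A]
    [Algebra k B] [Algebra A B] [IsScalarTower k A B] :
    Set.MapsTo (PrimeSpectrum.comap (algebraMap A B)) (rationalPoints k B)
      (rationalPoints k A) := by
  intro x hx
  refine ⟨(algebraMap k _).injective, fun z => ?_⟩
  let g := Ideal.ResidueField.map (PrimeSpectrum.comap (algebraMap A B) x).asIdeal x.asIdeal
    (algebraMap A B) rfl
  obtain ⟨c, hc⟩ := hx.2 (g z)
  refine ⟨c, g.injective ?_⟩
  rw [← hc, IsScalarTower.algebraMap_apply k A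
      (PrimeSpectrum.comap (algebraMap A B) x).asIdeal.ResidueField c,
    IsScalarTower.algebraMap_apply k B x.asIdeal.ResidueField c,
    IsScalarTower.algebraMap_apply k A B c]
  exact Ideal.ResidueField.map_algebraMap (PrimeSpectrum.comap (algebraMap A B) x).asIdeal
    x.asIdeal (algebraMap A B) rfl (algebraMap k A c)

/-- The map `f₀ : X(k) → Y(k)` induced on `k`-rational points by the `k`-morphism
`f : X = Spec B → Y = Spec A` of a homomorphism of `k`-algebras `A → B`. -/
def rationalPointsMap (k A B : Type*) [Field k] [CommRing A] [CommRing B] [Algebra k A]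
    [Algebra k B] [Algebra A B] [IsScalarTower k A B] :
    rationalPoints k B → rationalPoints k A :=
  (mapsTo_rationalPoints k A B).restrict

/-- For `X = Spec B → Y = Spec A`, `h ∈ B` and `y ∈ Y`, the (underlying space of the) geometric
fiber `D(h)_ȳ = D(h) ×_Y Spec κ̄_y` over `y` of the restriction `D(h) = Spec B_h → Y`, where `κ̄_y`
is an algebraic closure of the residue field of `y`. -/
abbrev GeometricFiber (A : Type*) {B : Type*} [CommRing A] [CommRing B] [Algebra A B]
    (h : B) (y : PrimeSpectrum A) : Type _ :=
  PrimeSpectrum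
    (TensorProduct A (Localization.Away h) (AlgebraicClosure y.asIdeal.ResidueField))

section Semialgebraic

variable {R : Type*} [Field R] [LinearOrder R]

/-- Basic semi-algebraic subsets of `Rⁿ`: solution sets of finitely many equations `f = 0` and
finitely many strict inequalities `g > 0` between polynomials. -/
def IsBasicSemialgebraic {n : ℕ} (S : Set (Fin n → R)) : Prop :=
  ∃ P Q : Finset (MvPolynomial (Fin n) R),
    S = {x | (∀ f ∈ P, MvPolynomial.eval x f = 0) ∧ ∀ g ∈ Q, 0 < MvPolynomial.eval x g}

/-- Semi-algebraic subsets of `Rⁿ`: finite unions of basic semi-algebraic sets. -/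
def IsSemialgebraic {n : ℕ} (S : Set (Fin n → R)) : Prop :=
  ∃ 𝒞 : Set (Set (Fin n → R)), 𝒞.Finite ∧ (∀ T ∈ 𝒞, IsBasicSemialgebraic T) ∧ S = ⋃₀ 𝒞

/-- The open ball `{x | ‖x - c‖ < r}` for the Euclidean norm, for `r > 0`. -/
def euclideanBall {n : ℕ} (c : Fin n → R) (r : R) : Set (Fin n → R) :=
  {x | ∑ i, (x i - c i) ^ 2 < r ^ 2}

/-- The Euclidean topology on `Rⁿ`, generated by the open balls of positive radius. -/
@[reducible]
def euclideanTopology (R : Type*) [Field R] [LinearOrder R] (n : ℕ) :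
    TopologicalSpace (Fin n → R) :=
  TopologicalSpace.generateFrom {U | ∃ (c : Fin n → R) (r : R), 0 < r ∧ U = euclideanBall c r}

/-- `T` is a subset of `S` that is closed in `S` for the Euclidean topology. -/
def IsEuclideanClosedIn {n : ℕ} (T S : Set (Fin n → R)) : Prop :=
  ∃ F : Set (Fin n → R), @IsClosed _ (euclideanTopology R n) F ∧ T = F ∩ S

/-- `S` is semi-algebraically connected: it is not the disjoint union of two non-empty
semi-algebraic subsets that are closed in `S`. -/
def IsSemialgebraicallyConnected {n : ℕ} (S : Set (Fin n → R)) : Prop :=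
  ¬ ∃ T₁ T₂ : Set (Fin n → R), T₁.Nonempty ∧ T₂.Nonempty ∧
    IsSemialgebraic T₁ ∧ IsSemialgebraic T₂ ∧
    IsEuclideanClosedIn T₁ S ∧ IsEuclideanClosedIn T₂ S ∧
    Disjoint T₁ T₂ ∧ T₁ ∪ T₂ = S

end Semialgebraic

/-- The injection `Y(R) → Rⁿ` induced by the closed immersion `Y = Spec A → 𝔸ⁿ_R` of a
surjection `φ : R[x₁, …, xₙ] → A`: a point `y` goes to the tuple of the values at `y` of the
coordinate functions `φ(xᵢ)`. -/
noncomputable def rationalPointCoords {R A : Type*} [Field R] [CommRing A] [Algebra R A] {n : ℕ}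
    (φ : MvPolynomial (Fin n) R →ₐ[R] A) (y : rationalPoints R A) : Fin n → R :=
  fun i => rationalPointEval y (φ (MvPolynomial.X i))

/-! Equip the free `A`-module `B` with the form Tr(h²x²). At a rational point y it specialises to
the same form on the finite `R`-algebra C = R ⊗[A] B, and Hermite's theorem (`sigPos_hermiteForm`)
reads off its rank as the number of geometric points of the fiber with h ≠ 0 and its signature as
the number of rational ones. Indeed C modulo its nilradical is a product of fields of degree 1 or 2
over `R` (`IsRealClosed.finrank_eq_one_or_two`); where h does not vanish, a factor `R` contributes
one positive square and a factor R(i) a hyperbolic plane.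

So the rank N is constant on S, and it remains to treat the positive index p. Both p and the
negative index are lower semicontinuous (`isOpen_setOf_le_sigPos`), and their sum is N, so {p ≥ k}
and its complement are both closed in S. They are semi-algebraic because the signs of finitely many
polynomials determine the congruence class of the Hermite matrix (`exists_finset_sign_congruent`).
Connectedness of S then makes p constant, and the number of rational points is 2p - N. -/

/-! ### Finite extensions of a real closed field. -/

section RealClosedExtensions

variable {R : Type*} [Field R] [LinearOrder R] [IsStrictOrderedRing R]

theorem natDegree_minpoly_of_sq_eq_neg_one {L : Type*} [Field L] [Algebra R L]
    {i : L} (hi : i ^ 2 = -1) : (minpoly R i).natDegree = 2 := by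
  have hint : IsIntegral R i := ⟨Polynomial.X ^ 2 + 1, by monicity!, by simp [hi]⟩
  refine le_antisymm ?_ ((minpoly.two_le_natDegree_iff hint).mpr ?_)
  · have := Polynomial.natDegree_le_of_dvd (minpoly.dvd R i
      (p := Polynomial.X ^ 2 + 1) (by simp [hi])) (by
        apply Polynomial.Monic.ne_zero; monicity!)
    refine this.trans ?_
    compute_degree
  · rintro ⟨x, hx⟩
    refine absurd (sq_nonneg x) (not_le.mpr ?_)
    rw [show x ^ 2 = -1 from (algebraMap R L).injective ?_]
    · exact neg_one_lt_zero
    rw [map_pow, hx, hi]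
    simp

variable [IsRealClosed R]

/-- The minimal polynomial of a primitive element is irreducible of odd degree, so it has a root and
is linear. -/
theorem IsRealClosed.finrank_eq_one_of_odd {L : Type*} [Field L] [Algebra R L]
    [FiniteDimensional R L] (hodd : Odd (Module.finrank R L)) : Module.finrank R L = 1 := by
  obtain ⟨θ, hθ⟩ := Field.exists_primitive_element R L
  have hdeg : (minpoly R θ).natDegree = Module.finrank R L :=
    (Field.primitive_element_iff_minpoly_natDegree_eq R θ).mp hθ
  obtain ⟨x, hx⟩ := IsRealClosed.exists_isRoot_of_odd_natDegree (hdeg ▸ hodd)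
  rw [← hdeg]
  exact Polynomial.natDegree_eq_of_degree_eq_some
    (Polynomial.degree_eq_one_of_irreducible_of_root
      (minpoly.irreducible (Algebra.IsIntegral.isIntegral θ)) hx)

/-- The classical formula: with r = |x + iy|, take u² = (r + x)/2 and v² = (r - x)/2. Then 2uv = ±y,
and the sign of v is free. -/
theorem IsRealClosed.exists_sq_eq_add_mul {L : Type*} [Field L] [Algebra R L] {i : L}
    (hi : i ^ 2 = -1) (x y : R) :
    ∃ u v : R, (algebraMap R L u + algebraMap R L v * i) ^ 2 =
      algebraMap R L x + algebraMap R L y * i := by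
  obtain ⟨r, hr0, hr⟩ : ∃ r : R, 0 ≤ r ∧ r ^ 2 = x ^ 2 + y ^ 2 := by
    obtain ⟨r, hr⟩ := IsRealClosed.exists_eq_pow_of_nonneg
      (add_nonneg (sq_nonneg x) (sq_nonneg y)) two_ne_zero
    exact ⟨|r|, abs_nonneg r, by rw [sq_abs, hr]⟩
  have hrx : |x| ≤ r := abs_le_of_sq_le_sq (by nlinarith [sq_nonneg y]) hr0
  obtain ⟨h1, h2⟩ := abs_le.mp hrx
  obtain ⟨u, hu⟩ := IsRealClosed.exists_eq_pow_of_nonneg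
    (show 0 ≤ (r + x) / 2 by linarith) two_ne_zero
  obtain ⟨v, hv⟩ := IsRealClosed.exists_eq_pow_of_nonneg
    (show 0 ≤ (r - x) / 2 by linarith) two_ne_zero
  have huv : (2 * u * v) ^ 2 = y ^ 2 := by
    have : (2 * u * v) ^ 2 = 4 * (u ^ 2 * v ^ 2) := by ring
    rw [this, ← hu, ← hv]
    linear_combination hr
  have hx : u ^ 2 - v ^ 2 = x := by rw [← hu, ← hv]; ring
  have key : ∀ v' : R, u ^ 2 - v' ^ 2 = x → 2 * u * v' = y →
      (algebraMap R L u + algebraMap R L v' * i) ^ 2 =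
        algebraMap R L x + algebraMap R L y * i := by
    intro v' h1 h2
    rw [← h1, ← h2]
    simp only [map_sub, map_mul, map_pow, map_ofNat]
    linear_combination (algebraMap R L v') ^ 2 * hi
  rcases sq_eq_sq_iff_eq_or_eq_neg.mp huv with h | h
  · exact ⟨u, v, key v hx h⟩
  · exact ⟨u, -v, key (-v) (by rw [neg_sq, hx]) (by linear_combination -h)⟩

/-- Such an `L` would be quadratic over R(i); but every element of R(i) is a square there, so
completing the square solves every quadratic equation. -/
theorem IsRealClosed.finrank_ne_four {L : Type*} [Field L] [Algebra R L] [FiniteDimensional R L]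
    {i : L} (hi : i ^ 2 = -1) : Module.finrank R L ≠ 4 := by
  intro h4
  have hint : IsIntegral R i := Algebra.IsIntegral.isIntegral i
  let K := IntermediateField.adjoin R {i}
  have hK : Module.finrank R K = 2 := by
    rw [IntermediateField.adjoin.finrank hint,
      natDegree_minpoly_of_sq_eq_neg_one hi]
  have hKL : Module.finrank K L = 2 := by
    have := Module.finrank_mul_finrank R K L
    rw [hK, h4] at this
    omega
  have hsq : ∀ z : K, ∃ w : K, w ^ 2 = z := by
    rintro ⟨z, hz⟩
    have hz' : z ∈ Algebra.adjoin R {i} := by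
      rwa [← IntermediateField.mem_toSubalgebra,
        IntermediateField.adjoin_simple_toSubalgebra_of_isAlgebraic hint.isAlgebraic] at hz
    have hspan : ∃ x y : R, z = algebraMap R L x + algebraMap R L y * i := by
      clear hz
      induction hz' using Algebra.adjoin_induction with
      | mem t ht => exact ⟨0, 1, by simp [Set.mem_singleton_iff.mp ht]⟩
      | algebraMap r => exact ⟨r, 0, by simp⟩
      | add a b _ _ ha hb =>
        obtain ⟨x, y, rfl⟩ := ha
        obtain ⟨x', y', rfl⟩ := hb
        exact ⟨x + x', y + y', by simp only [map_add]; ring⟩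
      | mul a b _ _ ha hb =>
        obtain ⟨x, y, rfl⟩ := ha
        obtain ⟨x', y', rfl⟩ := hb
        refine ⟨x * x' - y * y', x * y' + x' * y, ?_⟩
        simp only [map_add, map_mul, map_sub]
        linear_combination algebraMap R L y * algebraMap R L y' * hi
    obtain ⟨x, y, rfl⟩ := hspan
    obtain ⟨u, v, huv⟩ := IsRealClosed.exists_sq_eq_add_mul hi x y
    refine ⟨⟨algebraMap R L u + algebraMap R L v * i, ?_⟩, Subtype.ext huv⟩
    exact add_mem (K.algebraMap_mem u)
      (mul_mem (K.algebraMap_mem v) (IntermediateField.mem_adjoin_simple_self R i))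
  obtain ⟨θ, hθ⟩ := Field.exists_primitive_element K L
  have hdeg : (minpoly K θ).natDegree = 2 :=
    ((Field.primitive_element_iff_minpoly_natDegree_eq K θ).mp hθ).trans hKL
  have hθint : IsIntegral K θ := Algebra.IsIntegral.isIntegral θ
  have hmon := minpoly.monic hθint
  have hroot : θ ^ 2 + algebraMap K L ((minpoly K θ).coeff 1) * θ
      + algebraMap K L ((minpoly K θ).coeff 0) = 0 := by
    have h := minpoly.aeval K θ
    rw [Polynomial.aeval_eq_sum_range, hdeg] at h
    simp only [Finset.sum_range_succ, Finset.sum_range_zero, Algebra.smul_def] at h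
    have h2 : (minpoly K θ).coeff 2 = 1 := by rw [← hdeg]; exact hmon.coeff_natDegree
    rw [h2] at h
    simp only [map_one] at h
    linear_combination h
  set b := (minpoly K θ).coeff 1
  set c := (minpoly K θ).coeff 0
  obtain ⟨w, hw⟩ := hsq (b ^ 2 / 4 - c)
  have : CharZero L := charZero_of_injective_algebraMap (algebraMap R L).injective
  have hsq2 : (θ + algebraMap K L (b / 2)) ^ 2 = (algebraMap K L w) ^ 2 := by
    rw [← map_pow, hw]
    simp only [map_sub, map_div₀, map_pow, map_ofNat]
    linear_combination hroot
  have hmem : ∃ k : K, algebraMap K L k = θ := by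
    rcases sq_eq_sq_iff_eq_or_eq_neg.mp hsq2 with h | h
    · exact ⟨w - b / 2, by rw [map_sub, ← h]; ring⟩
    · exact ⟨-w - b / 2, by rw [map_sub, map_neg, ← h]; ring⟩
  have := (minpoly.two_le_natDegree_iff hθint).mp hdeg.ge
  exact this hmem

/-- The fixed field of a Sylow 2-subgroup has odd degree, hence is `R`, and the Galois group is a
2-group. If its order exceeded 2, an index-two subgroup of Gal(E/R(i)) would fix a field of degree 4
containing i. -/
theorem IsRealClosed.finrank_eq_two_of_isGalois {E : Type*} [Field E] [Algebra R E]
    [FiniteDimensional R E] [IsGalois R E] {i : E} (hi : i ^ 2 = -1) :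
    Module.finrank R E = 2 := by
  have h2 : Fact (Nat.Prime 2) := ⟨Nat.prime_two⟩
  let P : Sylow 2 Gal(E/R) := default
  have hodd : Odd (P : Subgroup Gal(E/R)).index := by
    rw [Nat.odd_iff, ← Nat.two_dvd_ne_zero]
    exact P.not_dvd_index
  have hfix : Module.finrank R (IntermediateField.fixedField (P : Subgroup Gal(E/R))) =
      (P : Subgroup Gal(E/R)).index := by
    rw [IntermediateField.finrank_eq_fixingSubgroup_index, IntermediateField.fixingSubgroup_fixedField]
  have hindex := IsRealClosed.finrank_eq_one_of_odd (hfix ▸ hodd)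
  rw [hfix, Subgroup.index_eq_one] at hindex
  obtain ⟨n, hn⟩ := P.isPGroup'.exists_card_eq
  have hcard : Module.finrank R E = 2 ^ n := by
    rw [← IsGalois.card_aut_eq_finrank R E, ← hn, hindex, Subgroup.card_top]
  let K := IntermediateField.adjoin R {i}
  have hK : Module.finrank R K = 2 := by
    rw [IntermediateField.adjoin.finrank (Algebra.IsIntegral.isIntegral i),
      natDegree_minpoly_of_sq_eq_neg_one hi]
  have hKE := Module.finrank_mul_finrank R K E
  have hH : Nat.card K.fixingSubgroup = Module.finrank K E :=
    IsGalois.card_fixingSubgroup_eq_finrank K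
  rw [hK, hcard] at hKE
  rcases n with _ | _ | n
  · omega
  · omega
  exfalso
  have hH' : Nat.card K.fixingSubgroup = 2 ^ (n + 1) := by
    rw [hH]; rw [pow_succ] at hKE; omega
  obtain ⟨H, hHcard⟩ := Sylow.exists_subgroup_card_pow_prime (G := K.fixingSubgroup) 2 (n := n)
    (hH' ▸ pow_dvd_pow 2 (Nat.le_succ n))
  let H' : Subgroup Gal(E/R) := H.map K.fixingSubgroup.subtype
  have hH'card : Nat.card H' = 2 ^ n := by
    rw [← hHcard]
    exact Nat.card_congr (H.equivMapOfInjective _ Subtype.val_injective).symm.toEquiv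
  let F := IntermediateField.fixedField H'
  have hF : Module.finrank R F * Module.finrank F E = Module.finrank R E :=
    Module.finrank_mul_finrank R F E
  have hFE : Module.finrank F E = 2 ^ n := by
    rw [IntermediateField.finrank_fixedField_eq_card, hH'card]
  have hiF : i ∈ F := by
    rintro ⟨g, hg⟩
    obtain ⟨k, -, rfl⟩ := hg
    exact k.2 ⟨i, IntermediateField.mem_adjoin_simple_self R i⟩
  refine IsRealClosed.finrank_ne_four (R := R) (L := F) (i := ⟨i, hiF⟩) (Subtype.ext hi) ?_
  rw [hFE, hcard, pow_add] at hF
  exact Nat.eq_of_mul_eq_mul_right (pow_pos two_pos n) (by rw [hF]; ring)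

/-- A proper finite extension of a real closed field is quadratic and contains a square root
of `-1`. -/
theorem IsRealClosed.finrank_eq_one_or_two (L : Type*) [Field L] [Algebra R L]
    [FiniteDimensional R L] :
    Module.finrank R L = 1 ∨ Module.finrank R L = 2 ∧ ∃ j : L, j ^ 2 = -1 := by
  let Ω := AlgebraicClosure L
  have : Algebra.IsAlgebraic R Ω := Algebra.IsAlgebraic.trans R L Ω
  obtain ⟨i, hi⟩ : ∃ i : Ω, i ^ 2 = -1 := IsAlgClosed.exists_pow_nat_eq (-1) two_pos
  have : IsAlgClosure R Ω := ⟨inferInstance, inferInstance⟩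
  have : Normal R Ω := IsAlgClosure.normal R Ω
  let K := IntermediateField.adjoin R {i}
  have hiint : IsIntegral R i := Algebra.IsIntegral.isIntegral i
  have : FiniteDimensional R K := IntermediateField.adjoin.finiteDimensional hiint
  let L₀ : IntermediateField R Ω := (IsScalarTower.toAlgHom R L Ω).fieldRange
  have eL : L ≃ₐ[R] L₀ := AlgEquiv.ofInjectiveField (IsScalarTower.toAlgHom R L Ω)
  have : FiniteDimensional R L₀ := eL.toLinearEquiv.finiteDimensional
  -- Adjoining i before taking the normal closure forces `E` to have degree 2, so the copy of `L` in
  -- it is either `R` or all of `E`.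
  let E := IntermediateField.normalClosure R (L₀ ⊔ K : IntermediateField R Ω) Ω
  have hle : L₀ ⊔ K ≤ E := IntermediateField.le_normalClosure _
  have hiE : i ∈ E := hle ((le_sup_right : K ≤ L₀ ⊔ K)
    (IntermediateField.mem_adjoin_simple_self R i))
  have hE : Module.finrank R E = 2 :=
    IsRealClosed.finrank_eq_two_of_isGalois (i := (⟨i, hiE⟩ : E)) (Subtype.ext hi)
  have hL₀E : L₀ ≤ E := le_sup_left.trans hle
  have hrank : Module.finrank R L = Module.finrank R L₀ := eL.toLinearEquiv.finrank_eq
  have hle2 : Module.finrank R L₀ ≤ 2 := by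
    rw [← hE]
    exact LinearMap.finrank_le_finrank_of_injective
      (f := (IntermediateField.inclusion hL₀E).toLinearMap)
      (IntermediateField.inclusion hL₀E).injective
  have hpos : 0 < Module.finrank R L := Module.finrank_pos
  by_cases h1 : Module.finrank R L = 1
  · exact Or.inl h1
  have h2 : Module.finrank R L = 2 := by omega
  have hL₀ : L₀ = E := IntermediateField.eq_of_le_of_finrank_eq hL₀E (by omega)
  refine Or.inr ⟨h2, eL.symm ⟨i, hL₀ ▸ hiE⟩, eL.injective ?_⟩
  rw [map_pow, AlgEquiv.apply_symm_apply, map_neg, map_one]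
  exact Subtype.ext hi

end RealClosedExtensions

/-! ### Bounds on the inertia of the Hermite form. -/

section HermiteForm

open QuadraticForm QuadraticMap

/-- The symmetric bilinear form `(x, y) ↦ Tr (h² x y)` of an algebra. -/
noncomputable def hermiteBilin (K : Type*) {C : Type*} [CommRing K] [CommRing C] [Algebra K C]
    (h : C) : LinearMap.BilinForm K C :=
  (LinearMap.mul K C).compr₂ (Algebra.trace K C ∘ₗ LinearMap.mulLeft K (h ^ 2))

theorem hermiteBilin_apply {K C : Type*} [CommRing K] [CommRing C] [Algebra K C] (h x y : C) :
    hermiteBilin K h x y = Algebra.trace K C (h ^ 2 * (x * y)) := rfl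

/-- The quadratic form `x ↦ Tr (h² x²)` of an algebra. -/
noncomputable def hermiteForm (K : Type*) {C : Type*} [CommRing K] [CommRing C] [Algebra K C]
    (h : C) : QuadraticForm K C :=
  LinearMap.BilinMap.toQuadraticMap (hermiteBilin K h)

theorem hermiteForm_apply {K C : Type*} [CommRing K] [CommRing C] [Algebra K C] (h x : C) :
    hermiteForm K h x = Algebra.trace K C (h ^ 2 * (x * x)) := rfl

/-- Positivity already forces `f` to be injective, so families of test vectors can be used without
first proving independence. -/
theorem finrank_le_sigPos_of_forall_pos {K V M : Type*} [Field K] [LinearOrder K]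
    [AddCommGroup V] [Module K V] [AddCommGroup M] [Module K M] [FiniteDimensional K M]
    {Q : QuadraticForm K M} (f : V →ₗ[K] M) (hf : ∀ v, v ≠ 0 → 0 < Q (f v)) :
    Module.finrank K V ≤ sigPos Q := by
  have hinj : Function.Injective f := by
    rw [← LinearMap.ker_eq_bot, LinearMap.ker_eq_bot']
    intro v hv
    by_contra hne
    have := hf v hne
    simp [hv] at this
  rw [← LinearMap.finrank_range_of_inj hinj]
  refine le_sigPos_of_posDef Q ?_
  rintro ⟨_, v, rfl⟩ hv
  exact hf v (by rintro rfl; simp at hv)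

variable {K C : Type*} [Field K] [CommRing C] [Algebra K C]

theorem Algebra.trace_eq_zero_of_isNilpotent {x : C} (hx : IsNilpotent x) :
    Algebra.trace K C x = 0 := by
  rw [Algebra.trace_apply]
  exact (LinearMap.isNilpotent_trace_of_isNilpotent (hx.map (Algebra.lmul K C))).eq_zero

variable [FiniteDimensional K C]

/-- Multiplication by `e` is a projection, whose trace is its rank. -/
theorem Algebra.trace_pos_of_isIdempotentElem [LinearOrder K] [IsStrictOrderedRing K] {e : C}
    (he : IsIdempotentElem e) (h0 : e ≠ 0) : 0 < Algebra.trace K C e := by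
  have he' : IsIdempotentElem (Algebra.lmul K C e : C →ₗ[K] C) := he.map (Algebra.lmul K C)
  rw [Algebra.trace_apply, (LinearMap.IsIdempotentElem.isProj_range _ he').trace, Nat.cast_pos]
  refine Nat.pos_of_ne_zero fun h => h0 ?_
  rw [Submodule.finrank_eq_zero, LinearMap.range_eq_bot] at h
  simpa using LinearMap.congr_fun h 1

theorem isNilpotent_of_forall_mem_maximalSpectrum {C : Type*} [CommRing C] [IsArtinianRing C]
    {x : C} (hx : ∀ m : MaximalSpectrum C, x ∈ m.asIdeal) : IsNilpotent x := by
  rw [← mem_nilradical, IsArtinianRing.nilradical_eq_iInf]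
  exact (Submodule.mem_iInf _).mpr hx

/-- Modulo the nilradical the ring is the product of its residue fields; the unit vectors lift
through a nil kernel. -/
theorem exists_orthogonalIdempotents_maximalSpectrum (C : Type*) [CommRing C]
    [IsArtinianRing C] :
    ∃ e : MaximalSpectrum C → C, OrthogonalIdempotents e ∧ (∀ m, e m - 1 ∈ m.asIdeal) ∧
      ∀ m m', m ≠ m' → e m ∈ m'.asIdeal := by
  classical
  have := Fintype.ofFinite (MaximalSpectrum C)
  let f : C →+* ∀ m : MaximalSpectrum C, C ⧸ m.asIdeal :=
    RingHom.comp (IsArtinianRing.quotNilradicalEquivPi C).toRingEquiv.toRingHom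
      (Ideal.Quotient.mk _)
  have hfapply : ∀ x m, f x m = Ideal.Quotient.mk m.asIdeal x := fun x m => rfl
  have hsurj : Function.Surjective f :=
    (IsArtinianRing.quotNilradicalEquivPi C).surjective.comp Ideal.Quotient.mk_surjective
  have hker : ∀ x ∈ RingHom.ker f, IsNilpotent x := by
    intro x hx
    refine isNilpotent_of_forall_mem_maximalSpectrum fun m => ?_
    rw [← Ideal.Quotient.eq_zero_iff_mem, ← hfapply, (RingHom.mem_ker).mp hx]
    rfl
  obtain ⟨e, he, hfe⟩ := OrthogonalIdempotents.lift_of_isNilpotent_ker f hker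
    (CompleteOrthogonalIdempotents.single
      fun m : MaximalSpectrum C => C ⧸ m.asIdeal).toOrthogonalIdempotents
    (fun m => hsurj _)
  have hval : ∀ m m', Ideal.Quotient.mk m'.asIdeal (e m) =
      (Pi.single m 1 : ∀ m : MaximalSpectrum C, C ⧸ m.asIdeal) m' := by
    intro m m'
    rw [← hfapply]
    exact congr_fun (congr_fun hfe m) m'
  refine ⟨e, he, fun m => ?_, fun m m' hm => ?_⟩
  · rw [← Ideal.Quotient.eq_zero_iff_mem, map_sub, hval, Pi.single_eq_same, map_one, sub_self]
  · rw [← Ideal.Quotient.eq_zero_iff_mem, hval, Pi.single_eq_of_ne hm.symm]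

/-- Maximal ideals at which `ε h⁻²` has a square root contribute to the positive index of
`ε Tr (h² x²)`. -/
theorem card_le_sigPos_smul_hermiteForm [LinearOrder K] [IsStrictOrderedRing K] (h : C) {ε : K}
    (hε : ε * ε = 1) {J : Type*} [Fintype J] (μ : J → MaximalSpectrum C)
    (hμ : Function.Injective μ) (g : J → C)
    (hg : ∀ j, h ^ 2 * (g j * g j) - algebraMap K C ε ∈ (μ j).asIdeal) :
    Fintype.card J ≤ sigPos (ε • hermiteForm K h) := by
  classical
  have : IsArtinianRing C := IsArtinianRing.of_finite K C
  obtain ⟨e, he, he1, he0⟩ := exists_orthogonalIdempotents_maximalSpectrum C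
  -- The difference of the two elements lies in every maximal ideal: in `μ j` by `hg`, in the others
  -- because of `e (μ j)`. So it is nilpotent and has trace 0.
  have htr : ∀ j, Algebra.trace K C (h ^ 2 * (g j * g j) * e (μ j)) =
      ε * Algebra.trace K C (e (μ j)) := by
    intro j
    rw [← smul_eq_mul ε, ← map_smul, ← sub_eq_zero, ← map_sub]
    refine Algebra.trace_eq_zero_of_isNilpotent
      (isNilpotent_of_forall_mem_maximalSpectrum fun m => ?_)
    rw [Algebra.smul_def, ← sub_mul]
    by_cases hm : μ j = m
    · exact Ideal.mul_mem_right _ _ (hm ▸ hg j)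
    · exact Ideal.mul_mem_left _ _ (he0 _ _ hm)
  have hpos : ∀ m, 0 < Algebra.trace K C (e m) := by
    intro m
    refine Algebra.trace_pos_of_isIdempotentElem (he.idem m) fun h0 => ?_
    have := he1 m
    rw [h0, zero_sub] at this
    exact m.isMaximal.ne_top ((Ideal.eq_top_iff_one _).mpr (by simpa using neg_mem this))
  rw [← Module.finrank_fintype_fun_eq_card (R := K) (η := J)]
  -- On the test vectors `e (μ j) * g j` the form is diagonal; its entries are ε² Tr(e) = Tr(e) > 0.
  refine finrank_le_sigPos_of_forall_pos
    (Fintype.linearCombination K fun j => e (μ j) * g j) fun c hc => ?_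
  have hval : h ^ 2 * ((Fintype.linearCombination K fun j => e (μ j) * g j) c *
      (Fintype.linearCombination K fun j => e (μ j) * g j) c) =
      ∑ j, (c j * c j) • (h ^ 2 * (g j * g j) * e (μ j)) := by
    rw [Fintype.linearCombination_apply, Finset.sum_mul, Finset.mul_sum]
    refine Finset.sum_congr rfl fun j _ => ?_
    rw [Finset.mul_sum, Finset.sum_eq_single j]
    · have := (he.idem (μ j)).eq
      simp only [Algebra.smul_def, map_mul]
      linear_combination (algebraMap K C (c j) * algebraMap K C (c j) * h ^ 2 * g j * g j) * this
    · intro k _ hk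
      have := he.ortho (fun hjk => hk (hμ hjk).symm : μ j ≠ μ k)
      simp only [Algebra.smul_def]
      linear_combination (algebraMap K C (c j) * algebraMap K C (c k) * g j * g k) * this
    · simp
  rw [_root_.smul_apply, hermiteForm_apply, hval, map_sum, smul_eq_mul, Finset.mul_sum]
  have hterm : ∀ j, ε * Algebra.trace K C ((c j * c j) • (h ^ 2 * (g j * g j) * e (μ j))) =
      c j * c j * Algebra.trace K C (e (μ j)) := by
    intro j
    rw [map_smul, htr, smul_eq_mul]
    linear_combination c j * c j * Algebra.trace K C (e (μ j)) * hε
  simp only [hterm]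
  obtain ⟨j, hj⟩ := Function.ne_iff.mp hc
  exact Finset.sum_pos' (fun j _ => mul_nonneg (mul_self_nonneg _) (hpos _).le)
    ⟨j, Finset.mem_univ j, mul_pos (mul_self_pos.mpr hj) (hpos _)⟩

/-- If x vanishes on `I`, then hx is nilpotent and x is in the radical. Hence the rank is at most
the dimension of the image in the product of the residue fields over `I`. -/
theorem finrank_le_sum_add_finrank_radical_hermiteForm (h : C) (I : Finset (MaximalSpectrum C))
    (hI : ∀ m, m ∉ I → h ∈ m.asIdeal) :
    Module.finrank K C ≤
      ∑ m ∈ I, Module.finrank K (C ⧸ m.asIdeal) +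
        Module.finrank K (hermiteForm K h).radical := by
  have : IsArtinianRing C := IsArtinianRing.of_finite K C
  let f : C →ₗ[K] ∀ m : I, C ⧸ m.1.asIdeal :=
    LinearMap.pi fun m => (Ideal.Quotient.mkₐ K m.1.asIdeal).toLinearMap
  have hker : LinearMap.ker f ≤ (hermiteForm K h).radical := by
    intro x hx
    have hx' : ∀ m : I, x ∈ m.1.asIdeal := by
      intro m
      rw [← Ideal.Quotient.eq_zero_iff_mem]
      exact congr_fun (LinearMap.mem_ker.mp hx) m
    have hnil : IsNilpotent (h * x) := isNilpotent_of_forall_mem_maximalSpectrum fun m => by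
      by_cases hm : m ∈ I
      · exact Ideal.mul_mem_left _ _ (hx' ⟨m, hm⟩)
      · exact Ideal.mul_mem_right _ _ (hI m hm)
    rw [QuadraticMap.mem_radical_iff']
    constructor
    · rw [hermiteForm_apply]
      refine Algebra.trace_eq_zero_of_isNilpotent ?_
      rw [show h ^ 2 * (x * x) = h * x * (h * x) by ring]
      exact (Commute.all _ _).isNilpotent_mul_left hnil
    · intro y
      rw [hermiteForm_apply, hermiteForm_apply, ← sub_eq_zero, ← map_sub]
      refine Algebra.trace_eq_zero_of_isNilpotent ?_
      rw [show h ^ 2 * ((x + y) * (x + y)) - h ^ 2 * (y * y) = (h * x) * (h * (x + 2 * y)) by ring]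
      exact (Commute.all _ _).isNilpotent_mul_right hnil
  rw [← f.finrank_range_add_finrank_ker]
  refine add_le_add ?_ (Submodule.finrank_mono hker)
  refine (Submodule.finrank_le _).trans ?_
  rw [Module.finrank_pi_fintype, Finset.sum_coe_sort I fun m => Module.finrank K (C ⧸ m.asIdeal)]

end HermiteForm

/-! ### Counting characters of finite algebras. -/

section Characters

variable {K C : Type*} [Field K] [CommRing C] [Algebra K C]

theorem Ideal.ker_comp_quotientMkₐ (m : Ideal C) [m.IsMaximal] {F : Type*} [Field F]
    [Algebra K F] (ψ : C ⧸ m →ₐ[K] F) : RingHom.ker (ψ.comp (Ideal.Quotient.mkₐ K m)) = m := by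
  let := Ideal.Quotient.field m
  ext x
  rw [RingHom.mem_ker, AlgHom.comp_apply, Ideal.Quotient.mkₐ_eq_mk,
    ← Ideal.Quotient.eq_zero_iff_mem]
  exact map_eq_zero_iff ψ ψ.toRingHom.injective

/-- Characters of an Artinian algebra that do not vanish at `h`, sorted by their kernel. -/
noncomputable def sigmaMaximalSpectrumEquivAlgHom [IsArtinianRing C] (h : C) (F : Type*)
    [Field F] [Algebra K F] :
    (Σ m : {m : MaximalSpectrum C // h ∉ m.asIdeal}, (C ⧸ m.1.asIdeal →ₐ[K] F)) ≃
      {χ : C →ₐ[K] F // χ h ≠ 0} := by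
  have hker : ∀ (m : MaximalSpectrum C) (ψ : C ⧸ m.asIdeal →ₐ[K] F),
      RingHom.ker (ψ.comp (Ideal.Quotient.mkₐ K m.asIdeal)) = m.asIdeal := fun m ψ =>
    have := m.isMaximal
    m.asIdeal.ker_comp_quotientMkₐ ψ
  refine Equiv.ofBijective (fun p => ⟨p.2.comp (Ideal.Quotient.mkₐ K p.1.1.asIdeal), fun h0 =>
    p.1.2 ((hker p.1.1 p.2).le (RingHom.mem_ker.mpr h0))⟩) ⟨?_, ?_⟩
  · rintro ⟨⟨m, hm⟩, ψ⟩ ⟨⟨m', hm'⟩, ψ'⟩ heq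
    have heq' : ψ.comp (Ideal.Quotient.mkₐ K m.asIdeal) =
      ψ'.comp (Ideal.Quotient.mkₐ K m'.asIdeal) := congr_arg Subtype.val heq
    obtain rfl : m = m' := MaximalSpectrum.ext (by rw [← hker m ψ, heq', hker m' ψ'])
    obtain rfl : ψ = ψ' := Ideal.Quotient.algHom_ext K heq'
    rfl
  · rintro ⟨χ, hχ⟩
    have : (RingHom.ker χ).IsPrime := RingHom.ker_isPrime χ
    exact ⟨⟨⟨⟨RingHom.ker χ, IsArtinianRing.isMaximal_of_isPrime _⟩, hχ⟩,
      Ideal.Quotient.liftₐ (RingHom.ker χ) χ fun _ ha => ha⟩, Subtype.ext (AlgHom.ext fun _ => rfl)⟩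

theorem card_algHom_eq_sum [FiniteDimensional K C] [Fintype (MaximalSpectrum C)] (h : C)
    [DecidablePred fun m : MaximalSpectrum C => h ∉ m.asIdeal]
    (F : Type*) [Field F] [Algebra K F] :
    Nat.card {χ : C →ₐ[K] F // χ h ≠ 0} =
      ∑ m with h ∉ MaximalSpectrum.asIdeal m, Nat.card (C ⧸ m.asIdeal →ₐ[K] F) := by
  have : IsArtinianRing C := IsArtinianRing.of_finite K C
  have hfin : ∀ m : MaximalSpectrum C, Finite (C ⧸ m.asIdeal →ₐ[K] F) := fun m =>
    have := m.isMaximal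
    let := Ideal.Quotient.field m.asIdeal
    inferInstance
  rw [← Nat.card_congr (sigmaMaximalSpectrumEquivAlgHom h F), Nat.card_sigma,
    Finset.sum_subtype (p := fun m : MaximalSpectrum C => h ∉ m.asIdeal) _ (by simp)
      fun m => Nat.card (C ⧸ m.asIdeal →ₐ[K] F)]

theorem card_algHom_self_of_finrank_eq_one {L : Type*} [Field L] [Algebra K L]
    (h1 : Module.finrank K L = 1) : Nat.card (L →ₐ[K] K) = 1 := by
  have hbij : Function.Bijective (algebraMap K L) :=
    Algebra.finrank_eq_one_iff_bijective_algebraMap.mp h1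
  let e : K ≃ₐ[K] L := AlgEquiv.ofBijective (Algebra.ofId K L) hbij
  rw [Nat.card_congr (e.symm.arrowCongr AlgEquiv.refl), Nat.card_unique]

theorem card_algHom_self_of_finrank_ne_one {L : Type*} [Field L] [Algebra K L]
    (h1 : Module.finrank K L ≠ 1) : Nat.card (L →ₐ[K] K) = 0 := by
  rw [Nat.card_eq_zero]
  refine Or.inl ⟨fun χ => h1 ?_⟩
  have hbij : Function.Bijective χ := ⟨χ.toRingHom.injective, fun r => ⟨algebraMap K L r, χ.commutes r⟩⟩
  rw [(AlgEquiv.ofBijective χ hbij).toLinearEquiv.finrank_eq, Module.finrank_self]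

end Characters

/-! ### Hermite's theorem over a real closed field. -/

section HermiteTheorem

open QuadraticForm QuadraticMap

variable {R C : Type*} [Field R] [LinearOrder R] [IsStrictOrderedRing R] [IsRealClosed R]
  [CommRing C] [Algebra R C] [FiniteDimensional R C]

/-- Hermite's theorem: rank and signature of the form `Tr (h² x²)` of a finite algebra over a real
closed field count the geometric and the rational points at which `h` does not vanish. -/
theorem sigPos_hermiteForm (h : C) (F : Type*) [Field F] [IsAlgClosed F] [Algebra R F] :
    sigPos (hermiteForm R h) + sigNeg (hermiteForm R h) =
        Nat.card {χ : C →ₐ[R] F // χ h ≠ 0} ∧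
      sigPos (hermiteForm R h) =
        sigNeg (hermiteForm R h) + Nat.card {χ : C →ₐ[R] R // χ h ≠ 0} := by
  classical
  have : IsArtinianRing C := IsArtinianRing.of_finite R C
  have := Fintype.ofFinite (MaximalSpectrum C)
  set I : Finset (MaximalSpectrum C) := {m | h ∉ m.asIdeal} with hI
  have hmemI : ∀ m, m ∈ I ↔ h ∉ m.asIdeal := fun m => by simp [hI]
  let d : MaximalSpectrum C → ℕ := fun m => Module.finrank R (C ⧸ m.asIdeal)
  have hfield : ∀ m : MaximalSpectrum C,
      (d m = 1 ∨ d m = 2 ∧ ∃ j : C ⧸ m.asIdeal, j ^ 2 = -1) ∧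
      Nat.card (C ⧸ m.asIdeal →ₐ[R] F) = d m ∧
      Nat.card (C ⧸ m.asIdeal →ₐ[R] R) = if d m = 1 then 1 else 0 := by
    intro m
    have := m.isMaximal
    let := Ideal.Quotient.field m.asIdeal
    refine ⟨IsRealClosed.finrank_eq_one_or_two _, ?_, ?_⟩
    · exact AlgHom.natCard_of_splits R (C ⧸ m.asIdeal) F fun _ => IsAlgClosed.splits _
    · split_ifs with h1
      · exact card_algHom_self_of_finrank_eq_one h1
      · exact card_algHom_self_of_finrank_ne_one h1
  have hN : Nat.card {χ : C →ₐ[R] F // χ h ≠ 0} = ∑ m ∈ I, d m := by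
    rw [card_algHom_eq_sum]
    exact Finset.sum_congr rfl fun m _ => (hfield m).2.1
  have hs : Nat.card {χ : C →ₐ[R] R // χ h ≠ 0} = (I.filter fun m => d m = 1).card := by
    rw [card_algHom_eq_sum, Finset.card_filter]
    exact Finset.sum_congr rfl fun m _ => (hfield m).2.2
  have hd : ∑ m ∈ I, d m = I.card + (I.filter fun m => ¬ d m = 1).card := by
    rw [Finset.card_eq_sum_ones I, Finset.card_filter, ← Finset.sum_add_distrib]
    refine Finset.sum_congr rfl fun m _ => ?_
    rcases (hfield m).1 with h1 | ⟨h1, -⟩ <;> simp [h1]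
  have hsplit := Finset.card_filter_add_card_filter_not (s := I) fun m => d m = 1
  have hinv : ∀ m : MaximalSpectrum C, h ∉ m.asIdeal → ∃ g : C, h * g - 1 ∈ m.asIdeal := by
    intro m hm
    have := m.isMaximal
    let := Ideal.Quotient.field m.asIdeal
    obtain ⟨g, hg⟩ := Ideal.Quotient.mk_surjective (Ideal.Quotient.mk m.asIdeal h)⁻¹
    refine ⟨g, ?_⟩
    rw [← Ideal.Quotient.eq_zero_iff_mem, map_sub, map_mul, hg, map_one,
      mul_inv_cancel₀ fun h0 => hm (Ideal.Quotient.eq_zero_iff_mem.mp h0), sub_self]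
  -- Every point of `I` contributes a positive square, through an inverse of h.
  have hpos : I.card ≤ sigPos (hermiteForm R h) := by
    choose g hg using fun m : I => hinv m.1 ((hmemI _).mp m.2)
    have := card_le_sigPos_smul_hermiteForm h (one_mul (1 : R)) (fun m : I => m.1)
      Subtype.val_injective g fun m => by
        rw [map_one, show h ^ 2 * (g m * g m) - 1 = (h * g m - 1) * (h * g m + 1) by ring]
        exact Ideal.mul_mem_right _ _ (hg m)
    rwa [one_smul, Fintype.card_coe] at this
  -- The quadratic points also contribute a negative square, through √-1 times an inverse of h.
  have hneg : (I.filter fun m => ¬ d m = 1).card ≤ sigNeg (hermiteForm R h) := by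
    have hj : ∀ m : I.filter fun m => ¬ d m = 1,
        ∃ g : C, h ^ 2 * (g * g) - algebraMap R C (-1) ∈ m.1.asIdeal := by
      rintro ⟨m, hm⟩
      obtain ⟨hmI, hm1⟩ := Finset.mem_filter.mp hm
      obtain ⟨g, hg⟩ := hinv m ((hmemI _).mp hmI)
      obtain ⟨-, j, hj⟩ := (hfield m).1.resolve_left hm1
      obtain ⟨j, rfl⟩ := Ideal.Quotient.mk_surjective j
      have hj' : j ^ 2 + 1 ∈ m.asIdeal := by
        rw [← Ideal.Quotient.eq_zero_iff_mem, map_add, map_pow, hj, map_one, neg_add_cancel]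
      refine ⟨g * j, ?_⟩
      rw [map_neg, map_one, show h ^ 2 * (g * j * (g * j)) - -1 =
        (h * g - 1) * ((h * g + 1) * j ^ 2) + (j ^ 2 + 1) by ring]
      exact add_mem (Ideal.mul_mem_right _ _ hg) hj'
    choose g hg using hj
    have := card_le_sigPos_smul_hermiteForm h (show (-1 : R) * -1 = 1 by ring)
      (fun m : I.filter fun m => ¬ d m = 1 => m.1) Subtype.val_injective g hg
    rwa [show (-1 : R) • hermiteForm R h = -hermiteForm R h by ext; simp, Fintype.card_coe,
      sigPos_neg] at this
  have hrad := finrank_le_sum_add_finrank_radical_hermiteForm (K := R) h I fun m hm => by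
    simpa [hmemI] using hm
  have hsum := sigPos_add_sigNeg_add_radical (Q := hermiteForm R h)
  change _ ≤ ∑ m ∈ I, d m + _ at hrad
  -- The lower bounds `hpos` and `hneg` add up to Σ d, which by `hrad` is an upper bound for the
  -- rank, so both are equalities.
  omega

end HermiteTheorem

/-! ### Congruence of symmetric matrices and signs of polynomials. -/

section MatrixCongruence

open Matrix

/-- Congruence of square matrices. -/
def MatrixCongruent {ι R : Type*} [Fintype ι] [DecidableEq ι] [CommRing R]
    (M N : Matrix ι ι R) : Prop :=
  ∃ P : Matrix ι ι R, IsUnit P ∧ Pᵀ * M * P = N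

namespace MatrixCongruent

variable {ι κ R : Type*} [Fintype ι] [DecidableEq ι] [Fintype κ] [DecidableEq κ] [CommRing R]

theorem refl (M : Matrix ι ι R) : MatrixCongruent M M := ⟨1, isUnit_one, by simp⟩

theorem symm {M N : Matrix ι ι R} (h : MatrixCongruent M N) : MatrixCongruent N M := by
  obtain ⟨P, ⟨u, rfl⟩, rfl⟩ := h
  refine ⟨↑u⁻¹, Units.isUnit _, ?_⟩
  calc _ = (u.val * u⁻¹.val)ᵀ * M * (u.val * u⁻¹.val) := by
        rw [Matrix.transpose_mul]; simp only [Matrix.mul_assoc]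
    _ = M := by rw [u.mul_inv]; simp

theorem trans {M N L : Matrix ι ι R} (h : MatrixCongruent M N) (h' : MatrixCongruent N L) :
    MatrixCongruent M L := by
  obtain ⟨P, hP, rfl⟩ := h
  obtain ⟨Q, hQ, rfl⟩ := h'
  exact ⟨P * Q, hP.mul hQ, by rw [Matrix.transpose_mul]; simp only [Matrix.mul_assoc]⟩

theorem of_submatrix (e : κ ≃ ι) {M N : Matrix ι ι R}
    (h : MatrixCongruent (M.submatrix e e) (N.submatrix e e)) : MatrixCongruent M N := by
  obtain ⟨P, hP, hN⟩ := h
  refine ⟨P.submatrix e.symm e.symm, ?_, ?_⟩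
  · exact hP.map (Matrix.reindexAlgEquiv R R e)
  · have : M = (M.submatrix e e).submatrix e.symm e.symm := by simp
    rw [this, Matrix.transpose_submatrix, Matrix.submatrix_mul_equiv, Matrix.submatrix_mul_equiv,
      hN]
    simp

theorem fromBlocks {A A' : Matrix ι ι R} {D D' : Matrix κ κ R} (hA : MatrixCongruent A A')
    (hD : MatrixCongruent D D') :
    MatrixCongruent (Matrix.fromBlocks A 0 0 D) (Matrix.fromBlocks A' 0 0 D') := by
  obtain ⟨P, hP, rfl⟩ := hA
  obtain ⟨Q, hQ, rfl⟩ := hD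
  refine ⟨Matrix.fromBlocks P 0 0 Q, ?_, ?_⟩
  · rw [Matrix.isUnit_iff_isUnit_det] at hP hQ ⊢
    rw [Matrix.det_fromBlocks_zero₂₁]
    exact hP.mul hQ
  · simp [Matrix.fromBlocks_multiply, Matrix.fromBlocks_transpose]

theorem equivalent {M N : Matrix ι ι R} (h : MatrixCongruent M N) :
    QuadraticMap.Equivalent M.toQuadraticForm' N.toQuadraticForm' := by
  obtain ⟨P, hP, rfl⟩ := h
  have hdet := (Matrix.isUnit_iff_isUnit_det P).mp hP
  refine QuadraticMap.Equivalent.symm ⟨⟨Matrix.toLinearEquiv' P hP.invertible, fun v => ?_⟩⟩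
  simp only [Matrix.toQuadraticForm', LinearMap.BilinMap.toQuadraticMap_apply,
    Matrix.toLinearMap₂'_apply']
  change (P *ᵥ v) ⬝ᵥ M *ᵥ (P *ᵥ v) = _
  simp only [← Matrix.mulVec_mulVec, Matrix.dotProduct_mulVec, Matrix.vecMul_transpose]

end MatrixCongruent

/-- The Schur complement of a symmetric matrix at a diagonal entry, with denominators cleared. -/
def Matrix.clearedSchur {ι R : Type*} [DecidableEq ι] [Fintype ι] [CommRing R]
    (M : Matrix ι ι R) (i : ι) : Matrix {j // ¬ j = i} {j // ¬ j = i} R :=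
  M i i • (M i i • M.toBlock (¬ · = i) (¬ · = i) -
    (M.toBlock (· = i) (¬ · = i))ᵀ * M.toBlock (· = i) (¬ · = i))

variable {ι R : Type*} [Fintype ι] [DecidableEq ι]

theorem Matrix.clearedSchur_map {S : Type*} [CommRing R] [CommRing S] (f : R →+* S)
    (M : Matrix ι ι R) (i : ι) : (M.map f).clearedSchur i = (M.clearedSchur i).map f := by
  ext j k
  simp [Matrix.clearedSchur, Matrix.mul_apply]

theorem Matrix.IsSymm.clearedSchur [CommRing R] {M : Matrix ι ι R} (hM : M.IsSymm) (i : ι) :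
    (M.clearedSchur i).IsSymm := by
  ext j k
  simp [Matrix.clearedSchur, Matrix.mul_apply, hM.apply, mul_comm]

/-- Completing the square at the pivot, with the remaining basis vectors scaled by `M i i` to avoid
division. The new entries are thus polynomial in the old ones. -/
theorem MatrixCongruent.submatrix_fromBlocks_clearedSchur [Field R] {M : Matrix ι ι R}
    (hM : M.IsSymm) {i : ι} (hi : M i i ≠ 0) :
    MatrixCongruent (M.submatrix (Equiv.sumCompl (· = i)) (Equiv.sumCompl (· = i)))
      (Matrix.fromBlocks (M i i • 1) 0 0 (M.clearedSchur i)) := by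
  set B := M.toBlock (· = i) (¬ · = i) with hB
  have hblock : M.submatrix (Equiv.sumCompl (· = i)) (Equiv.sumCompl (· = i)) =
      Matrix.fromBlocks (M i i • 1) B Bᵀ (M.toBlock (¬ · = i) (¬ · = i)) := by
    ext a b
    rcases a with ⟨a, rfl⟩ | a <;> rcases b with b | b
    · obtain ⟨b, rfl⟩ := b
      simp
    · simp [hB]
    · simp [hB, hM.apply]
    · simp
  refine ⟨Matrix.fromBlocks 1 (-B) 0 (M i i • 1), ?_, ?_⟩
  · rw [Matrix.isUnit_iff_isUnit_det, Matrix.det_fromBlocks_zero₂₁, Matrix.det_smul]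
    simp [hi]
  · rw [hblock, Matrix.clearedSchur]
    simp [Matrix.fromBlocks_multiply, Matrix.fromBlocks_transpose, sub_eq_neg_add, hB]

/-- Nonzero pivots of equal sign differ by a square factor, since positive elements of `R` are
squares. -/
theorem MatrixCongruent.of_clearedSchur [Field R] [LinearOrder R] [IsStrictOrderedRing R]
    [IsRealClosed R] {M N : Matrix ι ι R} (hM : M.IsSymm) (hN : N.IsSymm) {i : ι}
    (hi : M i i ≠ 0) (hsign : SignType.sign (M i i) = SignType.sign (N i i))
    (h : MatrixCongruent (M.clearedSchur i) (N.clearedSchur i)) : MatrixCongruent M N := by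
  have hi' : N i i ≠ 0 := by
    rw [← sign_ne_zero, ← hsign, sign_ne_zero]
    exact hi
  have hpos : 0 < N i i / M i i := by
    rw [← sign_eq_one_iff, div_eq_mul_inv, sign_mul, ← hsign, ← sign_mul, sign_eq_one_iff,
      mul_inv_cancel₀ hi]
    exact one_pos
  obtain ⟨c, hc⟩ := IsRealClosed.exists_eq_pow_of_nonneg hpos.le two_ne_zero
  have hc0 : c ≠ 0 := by
    rintro rfl
    simp at hc
    tauto
  have hA : MatrixCongruent (M i i • (1 : Matrix {j // j = i} {j // j = i} R)) (N i i • 1) := by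
    refine ⟨c • 1, ?_, ?_⟩
    · rw [Matrix.isUnit_iff_isUnit_det, Matrix.det_smul]
      simp [hc0]
    · simp only [Matrix.transpose_smul, Matrix.transpose_one, Matrix.smul_mul, Matrix.mul_smul,
        Matrix.one_mul, smul_smul]
      congr 1
      rw [div_eq_iff hi] at hc
      rw [hc]
      ring
  exact MatrixCongruent.of_submatrix _
    ((MatrixCongruent.submatrix_fromBlocks_clearedSchur hM hi).trans
      ((hA.fromBlocks h).trans (MatrixCongruent.submatrix_fromBlocks_clearedSchur hN hi').symm))

/-- This is the value of the form at eᵢ + eⱼ (4 `M i i` when i = j). If all these values vanish at a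
point, so does the matrix there; otherwise one of them serves as a pivot. -/
theorem Matrix.transpose_transvection_mul_mul_apply_self [CommRing R] {M : Matrix ι ι R}
    (hM : M.IsSymm) (i j : ι) :
    ((transvection j i 1)ᵀ * M * transvection j i 1 : Matrix ι ι R) i i =
      M i i + 2 * M i j + M j j := by
  simp [transvection, Matrix.transpose_add, add_mul, mul_add, Matrix.add_apply,
    ← hM.apply i j]
  ring

/-- For i = j the matrix is diagonal with determinant 2, whence the characteristic assumption. -/
theorem Matrix.isUnit_transvection_one [Field R] [CharZero R] (i j : ι) :
    IsUnit (transvection i j (1 : R)) := by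
  rw [Matrix.isUnit_iff_isUnit_det]
  by_cases h : i = j
  · subst h
    have : transvection i i (1 : R) = Matrix.diagonal (Function.update 1 i 2) := by
      ext a b
      simp only [transvection, Matrix.add_apply, Matrix.one_apply, Matrix.single_apply,
        Matrix.diagonal_apply, Function.update_apply, Pi.one_apply]
      split_ifs <;> grind
    rw [this, Matrix.det_diagonal, isUnit_iff_ne_zero, Finset.prod_ne_zero_iff]
    intro k _
    by_cases hk : k = i
    · subst hk; simp
    · simp [hk]
  · rw [Matrix.det_transvection_of_ne _ _ h]
    exact isUnit_one

open MvPolynomial in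
/-- The signs of finitely many polynomials determine the congruence class of the value of a
symmetric polynomial matrix over a real closed field. -/
theorem exists_finset_sign_congruent [Field R] [LinearOrder R] [IsStrictOrderedRing R]
    [IsRealClosed R] {σ : Type*} {ι : Type*} [Fintype ι] [DecidableEq ι]
    (M : Matrix ι ι (MvPolynomial σ R)) (hM : M.IsSymm) :
    ∃ F : Finset (MvPolynomial σ R), ∀ x y,
      (∀ f ∈ F, SignType.sign (eval x f) = SignType.sign (eval y f)) →
        MatrixCongruent (M.map (eval x)) (M.map (eval y)) := by
  classical
  induction hn : Fintype.card ι generalizing ι with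
  | zero =>
    have := Fintype.card_eq_zero_iff.mp hn
    exact ⟨∅, fun x y _ => by
      rw [Subsingleton.elim (M.map (eval x)) (M.map (eval y))]; exact .refl _⟩
  | succ n ih =>
    let N : ι → ι → Matrix ι ι (MvPolynomial σ R) := fun i j =>
      (transvection j i 1)ᵀ * M * transvection j i 1
    have hN : ∀ i j, (N i j).IsSymm := fun i j => by
      simp only [N, Matrix.IsSymm, Matrix.transpose_mul, Matrix.transpose_transpose, hM.eq,
        Matrix.mul_assoc]
    have hNmap : ∀ i j (x : σ → R), (N i j).map (eval x) =
        (transvection j i 1)ᵀ * M.map (eval x) * transvection j i 1 := fun i j x => by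
      have : (transvection j i (1 : MvPolynomial σ R)).map (eval x) = transvection j i 1 := by
        ext a b
        simp [transvection, Matrix.one_apply, Matrix.single_apply, apply_ite (eval x)]
      simp only [N, Matrix.map_mul, Matrix.transpose_map, this]
    have hcongr : ∀ i j (x : σ → R), MatrixCongruent (M.map (eval x)) ((N i j).map (eval x)) :=
      fun i j x => ⟨transvection j i 1, Matrix.isUnit_transvection_one j i, (hNmap i j x).symm⟩
    -- Which pivot is nonzero depends on the point, so the induction is run for every pair (i, j)
    -- and all the resulting polynomials are collected.
    choose F hF using fun i j => ih ((N i j).clearedSchur i) ((hN i j).clearedSchur i)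
      (by simp [Fintype.card_subtype_compl, hn])
    refine ⟨Finset.univ.biUnion fun p : ι × ι => insert (N p.1 p.2 p.1 p.1) (F p.1 p.2),
      fun x y hxy => ?_⟩
    have hxy1 : ∀ i j, SignType.sign (eval x (N i j i i)) = SignType.sign (eval y (N i j i i)) :=
      fun i j => hxy _ (Finset.mem_biUnion.mpr ⟨(i, j), by simp, by simp⟩)
    by_cases h0 : ∃ i j, eval x (N i j i i) ≠ 0
    · obtain ⟨i, j, hij⟩ := h0
      refine (hcongr i j x).trans (MatrixCongruent.trans ?_ (hcongr i j y).symm)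
      refine MatrixCongruent.of_clearedSchur ((hN i j).map _) ((hN i j).map _) hij
        (hxy1 i j) ?_
      rw [Matrix.clearedSchur_map, Matrix.clearedSchur_map]
      exact hF i j x y fun f hf => hxy f (Finset.mem_biUnion.mpr ⟨(i, j), by simp, by simp [hf]⟩)
    · push Not at h0
      have hzero : ∀ z : σ → R, (∀ i j, eval z (N i j i i) = 0) → M.map (eval z) = 0 := by
        intro z hz
        have hz' : ∀ i j, eval z (M i i) + 2 * eval z (M i j) + eval z (M j j) = 0 := by
          intro i j
          rw [← hz i j]
          simp only [N, Matrix.transpose_transvection_mul_mul_apply_self hM, map_add, map_mul,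
            map_ofNat]
        have hdiag : ∀ i, eval z (M i i) = 0 := fun i => by linarith [hz' i i]
        ext i j
        simp only [Matrix.map_apply, Matrix.zero_apply]
        linarith [hz' i j, hdiag i, hdiag j]
      rw [hzero x h0, hzero y fun i j => by
        rw [← sign_eq_zero_iff, ← hxy1, h0, sign_zero]]
      exact .refl _

end MatrixCongruence

/-! ### Lower semicontinuity of the positive index. -/

section SignatureOpen

open QuadraticForm QuadraticMap

/-- An orthogonal basis gives a dominant family, with zero off-diagonal terms; conversely a strictly
diagonally dominant Gram matrix is positive definite. For fixed vectors, dominance is finitely many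
strict inequalities in values of `Q`, hence an open condition. -/
theorem QuadraticForm.le_sigPos_iff_exists_dominant {K V : Type*} [Field K] [LinearOrder K]
    [IsStrictOrderedRing K] [AddCommGroup V] [Module K V] [FiniteDimensional K V]
    (Q : QuadraticForm K V) (k : ℕ) :
    k ≤ sigPos Q ↔ ∃ w : Fin k → V, ∀ i,
      ∑ j ∈ Finset.univ.erase i, |polar Q (w i) (w j)| < polar Q (w i) (w i) := by
  classical
  constructor
  · intro hk
    have : Invertible (2 : K) := invertibleOfNonzero two_ne_zero
    obtain ⟨d, ⟨e⟩⟩ := Q.equivalent_weightedSumSquares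
    rw [sigPos_of_equiv_weightedSumSquares ⟨e⟩, Set.ncard_eq_toFinset_card',
      ← Fintype.card_coe] at hk
    obtain ⟨g⟩ := Function.Embedding.nonempty_of_card_le (α := Fin k) (by simpa using hk)
    have hgpos : ∀ i, 0 < d (g i) := fun i => by simpa using (g i).2
    have hpolar : ∀ i j, polar Q (e.symm (Pi.single (g i).1 1)) (e.symm (Pi.single (g j).1 1)) =
        if i = j then 2 * d (g i) else 0 := by
      intro i j
      simp only [polar, ← map_add, e.symm.map_app, weightedSumSquares_apply, smul_eq_mul,
        ← Finset.sum_sub_distrib]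
      rw [Finset.sum_eq_single (g i).1]
      · split_ifs with h
        · subst h
          simp
          ring
        · have hne : (g i).1 ≠ (g j).1 := fun h' => h (g.injective (Subtype.ext h'))
          simp [Pi.single_eq_of_ne hne]
      · intro b _ hb
        by_cases h : b = (g j).1 <;> simp [Pi.single_eq_of_ne hb]
      · simp
    refine ⟨fun i => e.symm (Pi.single (g i).1 1), fun i => ?_⟩
    rw [Finset.sum_eq_zero, hpolar, if_pos rfl]
    · linarith [hgpos i]
    · intro j hj
      rw [hpolar, if_neg (Finset.ne_of_mem_erase hj).symm, abs_zero]
  · rintro ⟨w, hw⟩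
    rw [← Fintype.card_fin k, ← Module.finrank_fintype_fun_eq_card (R := K) (η := Fin k)]
    refine finrank_le_sigPos_of_forall_pos (Fintype.linearCombination K w) fun c hc => ?_
    have h2 : 2 * Q (Fintype.linearCombination K w c) =
        ∑ i, ∑ j, c i * c j * polar Q (w i) (w j) := by
      rw [← smul_eq_mul, ← Nat.cast_ofNat (R := K), Nat.cast_smul_eq_nsmul, ← polar_self,
        ← polarBilin_apply_apply, Fintype.linearCombination_apply]
      simp only [map_sum, LinearMap.sum_apply, map_smul, LinearMap.smul_apply, smul_eq_mul,
        polarBilin_apply_apply, Finset.mul_sum]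
      rw [Finset.sum_comm]
      exact Finset.sum_congr rfl fun i _ => Finset.sum_congr rfl fun j _ => by ring
    set p : Fin k → Fin k → K := fun i j => polar Q (w i) (w j) with hp
    have hsymm : ∀ i j, p i j = p j i := fun i j => polar_comm _ _ _
    have hswap : ∑ i, ∑ j ∈ Finset.univ.erase i, |p i j| * c j ^ 2 =
        ∑ i, ∑ j ∈ Finset.univ.erase i, |p i j| * c i ^ 2 := by
      rw [Finset.sum_comm' (t' := Finset.univ) (s' := fun j => Finset.univ.erase j)
        (by simp [eq_comm])]
      exact Finset.sum_congr rfl fun i _ => Finset.sum_congr rfl fun j _ => by rw [hsymm]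
    -- This is |p|(cᵢ ± cⱼ)² ≥ 0, with the sign of p.
    have hterm : ∀ i j, -(|p i j| * c i ^ 2 + |p i j| * c j ^ 2) / 2 ≤ c i * c j * p i j := by
      intro i j
      rcases abs_cases (p i j) with ⟨h, h'⟩ | ⟨h, h'⟩ <;> rw [h]
      · nlinarith [mul_nonneg h' (sq_nonneg (c i + c j))]
      · nlinarith [mul_nonneg (neg_nonneg.mpr h'.le) (sq_nonneg (c i - c j))]
    have hlower : ∑ i, c i ^ 2 * (p i i - ∑ j ∈ Finset.univ.erase i, |p i j|) ≤
        ∑ i, ∑ j, c i * c j * p i j := by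
      calc _ = ∑ i, (c i ^ 2 * p i i + ∑ j ∈ Finset.univ.erase i,
              -(|p i j| * c i ^ 2 + |p i j| * c j ^ 2) / 2) := by
            simp only [neg_div, add_div, Finset.sum_neg_distrib, Finset.sum_add_distrib,
              ← Finset.sum_div, hswap]
            rw [← sub_eq_add_neg, ← sub_eq_zero]
            have hmul : ∀ i, c i ^ 2 * (p i i - ∑ j ∈ Finset.univ.erase i, |p i j|) =
                c i ^ 2 * p i i - (∑ j ∈ Finset.univ.erase i, |p i j|) * c i ^ 2 :=
              fun i => by ring
            simp only [hmul, Finset.sum_sub_distrib, ← Finset.sum_mul]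
            ring
        _ ≤ _ := by
            refine Finset.sum_le_sum fun i _ => ?_
            rw [← Finset.add_sum_erase _ _ (Finset.mem_univ i)]
            refine add_le_add (le_of_eq (by ring)) (Finset.sum_le_sum fun j _ => hterm i j)
    have hpos : 0 < ∑ i, c i ^ 2 * (p i i - ∑ j ∈ Finset.univ.erase i, |p i j|) := by
      obtain ⟨i, hi⟩ := Function.ne_iff.mp hc
      exact Finset.sum_pos' (fun i _ => mul_nonneg (sq_nonneg _) (sub_pos.mpr (hw i)).le)
        ⟨i, Finset.mem_univ i, mul_pos (sq_pos_of_ne_zero hi) (sub_pos.mpr (hw i))⟩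
    linarith

/-- The positive index of inertia is lower semicontinuous. -/
theorem isOpen_setOf_le_sigPos {K V X : Type*} [Field K] [LinearOrder K] [IsStrictOrderedRing K]
    [TopologicalSpace K] [OrderTopology K] [AddCommGroup V] [Module K V] [FiniteDimensional K V]
    [TopologicalSpace X] (Q : X → QuadraticForm K V) (hQ : ∀ v, Continuous fun x => Q x v)
    (k : ℕ) : IsOpen {x | k ≤ sigPos (Q x)} := by
  have hpolar : ∀ v w, Continuous fun x => polar (Q x) v w := fun v w =>
    ((hQ (v + w)).sub (hQ v)).sub (hQ w)
  simp only [QuadraticForm.le_sigPos_iff_exists_dominant, Set.ofPred_exists, Set.ofPred_forall]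
  exact isOpen_iUnion fun w => isOpen_iInter_of_finite fun i =>
    isOpen_lt (continuous_finsetSum _ fun j _ => (hpolar _ _).abs) (hpolar _ _)

end SignatureOpen

/-! ### Euclidean and product topologies. -/

section EuclideanTopology

/-- A ball of radius r projects into an interval of radius r, so the coordinates are
Euclidean-continuous. -/
theorem isOpen_euclideanTopology_of_pi {R : Type*} [Field R] [LinearOrder R]
    [IsStrictOrderedRing R] [TopologicalSpace R] [OrderTopology R] {n : ℕ}
    {U : Set (Fin n → R)} (hU : IsOpen U) : @IsOpen _ (euclideanTopology R n) U := by
  suffices h : euclideanTopology R n ≤ Pi.topologicalSpace from h U hU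
  rw [Pi.topologicalSpace, le_iInf_iff]
  intro i
  rw [← continuous_iff_le_induced]
  have hball : ∀ (x : Fin n → R) (r : R), 0 < r →
      @IsOpen _ (euclideanTopology R n) (euclideanBall x r) ∧ x ∈ euclideanBall x r ∧
        ∀ z ∈ euclideanBall x r, |z i - x i| < r := by
    intro x r hr
    refine ⟨TopologicalSpace.isOpen_generateFrom_of_mem ⟨x, r, hr, rfl⟩, ?_, fun z hz => ?_⟩
    · simpa [euclideanBall] using pow_pos hr 2
    · refine abs_lt_of_sq_lt_sq (lt_of_le_of_lt ?_ hz) hr.le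
      exact Finset.single_le_sum (f := fun j => (z j - x j) ^ 2) (fun j _ => sq_nonneg _)
        (Finset.mem_univ i)
  let _ := euclideanTopology R n
  rw [OrderTopology.topology_eq_generate_intervals (α := R), continuous_generateFrom_iff]
  rintro _ ⟨a, rfl | rfl⟩ <;> refine isOpen_iff_forall_mem_open.mpr fun x hx => ?_
  · obtain ⟨h1, h2, h3⟩ := hball x (x i - a) (sub_pos.mpr hx)
    refine ⟨_, fun z hz => ?_, h1, h2⟩
    have := (abs_lt.mp (h3 z hz)).1
    change a < z i
    linarith
  · obtain ⟨h1, h2, h3⟩ := hball x (a - x i) (sub_pos.mpr hx)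
    refine ⟨_, fun z hz => ?_, h1, h2⟩
    have := (abs_lt.mp (h3 z hz)).2
    change z i < a
    linarith

end EuclideanTopology

/-! ### Semi-algebraic sets cut out by sign conditions. -/

section Semialgebraic

variable {R : Type*} [Field R] [LinearOrder R] [IsStrictOrderedRing R]

open MvPolynomial

theorem IsBasicSemialgebraic.inter_sign_eq {n : ℕ} {C : Set (Fin n → R)}
    (hC : IsBasicSemialgebraic C) (F : Finset (MvPolynomial (Fin n) R))
    (s : MvPolynomial (Fin n) R → SignType) :
    IsBasicSemialgebraic (C ∩ {x | ∀ f ∈ F, SignType.sign (eval x f) = s f}) := by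
  classical
  obtain ⟨P, Q, rfl⟩ := hC
  refine ⟨P ∪ F.filter (s · = 0),
    Q ∪ (F.filter (s · = 1) ∪ (F.filter (s · = -1)).image (-·)), ?_⟩
  ext x
  simp only [Set.mem_inter_iff, Set.mem_ofPred_eq, Finset.mem_union, Finset.mem_filter,
    Finset.mem_image]
  constructor
  · rintro ⟨⟨hP, hQ⟩, hF⟩
    refine ⟨?_, ?_⟩
    · rintro f (hf | ⟨hf, h0⟩)
      · exact hP f hf
      · exact sign_eq_zero_iff.mp ((hF f hf).trans h0)
    · rintro f (hf | ⟨hf, h0⟩ | ⟨f, ⟨hf, h0⟩, rfl⟩)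
      · exact hQ f hf
      · exact sign_eq_one_iff.mp ((hF f hf).trans h0)
      · rw [map_neg, neg_pos]
        exact sign_eq_neg_one_iff.mp ((hF f hf).trans h0)
  · rintro ⟨hP, hQ⟩
    refine ⟨⟨fun f hf => hP f (Or.inl hf), fun f hf => hQ f (Or.inl hf)⟩, fun f hf => ?_⟩
    rcases hs : s f with _ | _ | _
    · exact sign_eq_zero_iff.mpr (hP f (Or.inr ⟨hf, hs⟩))
    · have := hQ (-f) (Or.inr (Or.inr ⟨f, ⟨hf, hs⟩, rfl⟩))
      rw [map_neg, neg_pos] at this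
      exact sign_eq_neg_one_iff.mpr this
    · exact sign_eq_one_iff.mpr (hQ f (Or.inr (Or.inl ⟨hf, hs⟩)))

/-- A part of a semi-algebraic set that is described by the signs of finitely many polynomials is
semi-algebraic. -/
theorem IsSemialgebraic.of_sign {n : ℕ} {S T : Set (Fin n → R)} (hS : IsSemialgebraic S)
    (hTS : T ⊆ S) (F : Finset (MvPolynomial (Fin n) R))
    (hF : ∀ x ∈ T, ∀ y ∈ S,
      (∀ f ∈ F, SignType.sign (eval x f) = SignType.sign (eval y f)) → y ∈ T) :
    IsSemialgebraic T := by
  classical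
  obtain ⟨𝒞, hfin, hbasic, rfl⟩ := hS
  -- Sign patterns on `F` form a finite type; the value 0 off `F` plays no role.
  let ext : (F → SignType) → MvPolynomial (Fin n) R → SignType :=
    fun s f => if hf : f ∈ F then s ⟨f, hf⟩ else 0
  let 𝒟 : Set (Set (Fin n → R)) :=
    Set.image2 (fun C s => C ∩ {x | ∀ f ∈ F, SignType.sign (eval x f) = ext s f}) 𝒞 Set.univ
  -- By `hF`, a cell that meets `T` lies inside `T`, so the cells contained in `T` cover it.
  refine ⟨{U ∈ 𝒟 | U ⊆ T}, (hfin.image2 _ Set.finite_univ).subset (Set.sep_subset _ _), ?_, ?_⟩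
  · rintro _ ⟨⟨C, hC, s, -, rfl⟩, -⟩
    exact (hbasic C hC).inter_sign_eq F (ext s)
  · refine subset_antisymm (fun x hx => ?_) (Set.sUnion_subset fun U hU => hU.2)
    obtain ⟨C, hC, hxC⟩ := hTS hx
    have hs : ∀ f ∈ F, SignType.sign (eval x f) =
        ext (fun g => SignType.sign (eval x g.1)) f := fun f hf => by simp [ext, hf]
    refine ⟨_, ⟨⟨C, hC, fun g => SignType.sign (eval x g.1), trivial, rfl⟩, ?_⟩, hxC, hs⟩
    rintro y ⟨hyC, hy⟩
    exact hF x hx y ⟨C, hC, hyC⟩ fun f hf => (hs f hf).trans (hy f hf).symm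

end Semialgebraic

/-! ### Rational points as characters. -/

section RationalPoints

variable {k A B : Type*} [Field k] [CommRing A] [CommRing B] [Algebra k A] [Algebra k B]

theorem algebraMap_rationalPointEval (y : rationalPoints k A) (a : A) :
    algebraMap k y.1.asIdeal.ResidueField (rationalPointEval y a) =
      algebraMap A y.1.asIdeal.ResidueField a :=
  (AlgEquiv.ofBijective (Algebra.ofId k y.1.asIdeal.ResidueField) y.2).apply_symm_apply _

theorem rationalPointEval_eq_zero_iff (y : rationalPoints k A) (a : A) :
    rationalPointEval y a = 0 ↔ a ∈ y.1.asIdeal := by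
  rw [← map_eq_zero_iff (algebraMap k y.1.asIdeal.ResidueField) (RingHom.injective _),
    algebraMap_rationalPointEval, Ideal.algebraMap_residueField_eq_zero]

theorem rationalPointEval_injective :
    Function.Injective (rationalPointEval : rationalPoints k A → A →ₐ[k] k) := by
  intro y y' h
  refine Subtype.ext (PrimeSpectrum.ext (Ideal.ext fun a => ?_))
  rw [← rationalPointEval_eq_zero_iff, ← rationalPointEval_eq_zero_iff, h]

/-- The element a - χ(a) is killed by χ, so a `k`-valued character is determined by its kernel. -/
theorem algHom_eq_of_ker_le {χ ψ : A →ₐ[k] k} (h : ∀ a, χ a = 0 → ψ a = 0) : χ = ψ := by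
  ext a
  have h0 : ψ (a - algebraMap k A (χ a)) = 0 := h _ (by simp)
  rw [map_sub, AlgHom.commutes, sub_eq_zero] at h0
  exact h0.symm

theorem rationalPointEval_surjective :
    Function.Surjective (rationalPointEval : rationalPoints k A → A →ₐ[k] k) := by
  intro χ
  have hprime : (RingHom.ker χ).IsPrime := RingHom.ker_isPrime χ
  have hsurj : Function.Surjective χ := fun r => ⟨algebraMap k A r, χ.commutes r⟩
  have hmax : (RingHom.ker χ).IsMaximal := RingHom.ker_isMaximal_of_surjective χ hsurj
  have hbij : Function.Bijective (algebraMap k (RingHom.ker χ).ResidueField) := by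
    refine ⟨RingHom.injective _, fun z => ?_⟩
    obtain ⟨q, rfl⟩ := (Ideal.bijective_algebraMap_quotient_residueField (RingHom.ker χ)).2 z
    obtain ⟨a, rfl⟩ := Ideal.Quotient.mk_surjective q
    refine ⟨χ a, ?_⟩
    rw [IsScalarTower.algebraMap_apply k A, ← Ideal.Quotient.algebraMap_eq,
      ← IsScalarTower.algebraMap_apply A, ← sub_eq_zero, ← map_sub,
      Ideal.algebraMap_residueField_eq_zero, RingHom.mem_ker, map_sub, AlgHom.commutes]
    exact sub_self _
  refine ⟨⟨⟨RingHom.ker χ, hprime⟩, hbij⟩, (algHom_eq_of_ker_le fun a ha => ?_).symm⟩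
  exact (rationalPointEval_eq_zero_iff _ _).mpr ha

theorem rationalPointEval_rationalPointsMap [Algebra A B] [IsScalarTower k A B]
    (x : rationalPoints k B) (a : A) :
    rationalPointEval (rationalPointsMap k A B x) a =
      rationalPointEval x (algebraMap A B a) := by
  have h : rationalPointEval (rationalPointsMap k A B x) =
      (rationalPointEval x).comp (IsScalarTower.toAlgHom k A B) :=
    algHom_eq_of_ker_le fun a ha =>
      (rationalPointEval_eq_zero_iff x _).mpr ((rationalPointEval_eq_zero_iff _ a).mp ha)
  rw [h]
  rfl

theorem eval_rationalPointCoords {n : ℕ} (φ : MvPolynomial (Fin n) k →ₐ[k] A)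
    (y : rationalPoints k A) (p : MvPolynomial (Fin n) k) :
    MvPolynomial.eval (rationalPointCoords φ y) p = rationalPointEval y (φ p) := by
  have h : MvPolynomial.aeval (rationalPointCoords φ y) = (rationalPointEval y).comp φ := by
    ext i
    simp [rationalPointCoords]
  rw [← MvPolynomial.coe_aeval_eq_eval]
  exact DFunLike.congr_fun h p

/-- The rational points of `D(h)` above `y` are the `A`-characters of `B` that do not vanish at
`h`, where `A` acts on `k` by evaluation at `y`. -/
theorem nonempty_rationalPoints_fiber_equiv [Algebra A B] [IsScalarTower k A B] (h : B)
    (y : rationalPoints k A) [Algebra A k]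
    (hy : ∀ a, algebraMap A k a = rationalPointEval y a) :
    Nonempty ({x : rationalPoints k B |
      rationalPointsMap k A B x = y ∧ x.1 ∈ PrimeSpectrum.basicOpen h} ≃
        {χ : B →ₐ[A] k // χ h ≠ 0}) := by
  refine ⟨Equiv.ofBijective (fun x => ⟨{ (rationalPointEval x.1 : B →+* k) with
    commutes' := fun a => ?_ }, ?_⟩) ⟨?_, ?_⟩⟩
  · change rationalPointEval x.1 (algebraMap A B a) = _
    rw [← rationalPointEval_rationalPointsMap, x.2.1, hy]
  · exact (rationalPointEval_eq_zero_iff x.1 h).not.mpr x.2.2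
  · intro x x' hxx'
    refine Subtype.ext (rationalPointEval_injective (AlgHom.ext fun b => ?_))
    exact DFunLike.congr_fun (congr_arg Subtype.val hxx') b
  · rintro ⟨χ, hχ⟩
    have hk : ∀ c : k, χ (algebraMap k B c) = c := by
      intro c
      rw [IsScalarTower.algebraMap_apply k A B, AlgHom.commutes, hy, AlgHom.commutes]
      rfl
    obtain ⟨x, hx⟩ := rationalPointEval_surjective
      ({ (χ : B →+* k) with commutes' := hk } : B →ₐ[k] k)
    have hx' : ∀ b, rationalPointEval x b = χ b := fun b => DFunLike.congr_fun hx b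
    refine ⟨⟨x, rationalPointEval_injective (AlgHom.ext fun a => ?_), fun h0 => hχ ?_⟩,
      Subtype.ext (AlgHom.ext hx')⟩
    · rw [rationalPointEval_rationalPointsMap, hx', AlgHom.commutes, hy]
    · rw [← hx']
      exact (rationalPointEval_eq_zero_iff x h).mpr h0

end RationalPoints

/-! ### Geometric points as characters. -/

section GeometricPoints

open TensorProduct

/-- Primes of `E` are maximal with residue field finite over `F`, so each is the kernel of exactly
one character. -/
theorem nonempty_primeSpectrum_equiv_algHom {F E : Type*} [Field F] [IsAlgClosed F] [CommRing E]
    [Algebra F E] [FiniteDimensional F E] (h : E) :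
    Nonempty ({χ : E →ₐ[F] F // χ h ≠ 0} ≃ {p : PrimeSpectrum E // p ∈ PrimeSpectrum.basicOpen h}) := by
  have : IsArtinianRing E := IsArtinianRing.of_finite F E
  refine ⟨Equiv.ofBijective (fun χ => ⟨⟨RingHom.ker χ.1, RingHom.ker_isPrime χ.1⟩, χ.2⟩)
    ⟨fun χ ψ hχψ => ?_, ?_⟩⟩
  · refine Subtype.ext (algHom_eq_of_ker_le fun a ha => ?_)
    have : RingHom.ker χ.1 = RingHom.ker ψ.1 :=
      congr_arg (fun p => p.1.asIdeal) hχψ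
    exact this.le ha
  · rintro ⟨p, hp⟩
    have hmax : p.asIdeal.IsMaximal := IsArtinianRing.isMaximal_of_isPrime _
    let := Ideal.Quotient.field p.asIdeal
    let ψ : E ⧸ p.asIdeal →ₐ[F] F := IsAlgClosed.lift
    have hker := p.asIdeal.ker_comp_quotientMkₐ ψ
    refine ⟨⟨ψ.comp (Ideal.Quotient.mkₐ F p.asIdeal), fun h0 => hp ?_⟩,
      Subtype.ext (PrimeSpectrum.ext hker)⟩
    exact hker.le h0

theorem nonempty_primeSpectrum_localizationAway_equiv {E : Type*} [CommRing E] (h : E) :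
    Nonempty (PrimeSpectrum (Localization.Away h) ≃
      {p : PrimeSpectrum E // p ∈ PrimeSpectrum.basicOpen h}) := by
  have hrange := PrimeSpectrum.localization_away_comap_range (Localization.Away h) h
  have hinj := PrimeSpectrum.localization_comap_injective (Localization.Away h)
    (Submonoid.powers h)
  exact ⟨(Equiv.ofInjective _ hinj).trans (Equiv.setCongr hrange)⟩

theorem nonempty_algHom_baseChange_equiv {A B K F : Type*} [CommRing A] [CommRing B]
    [Algebra A B] [CommRing K] [CommRing F] [Algebra A K] [Algebra K F] [Algebra A F]
    [IsScalarTower A K F] (h : B) :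
    Nonempty ({χ : B →ₐ[A] F // χ h ≠ 0} ≃ {χ : K ⊗[A] B →ₐ[K] F // χ (1 ⊗ₜ h) ≠ 0}) :=
  ⟨(AlgHom.liftEquiv A K B F).subtypeEquiv fun χ => by simp⟩

/-- The points of the geometric fiber of `D(h)` are the geometric characters of `B` that do not
vanish at `h`. -/
theorem nonempty_primeSpectrum_localization_tensorProduct_equiv {A B F : Type*} [CommRing A]
    [CommRing B] [Algebra A B] [Module.Finite A B] [Field F] [IsAlgClosed F] [Algebra A F]
    (h : B) :
    Nonempty (PrimeSpectrum (Localization.Away h ⊗[A] F) ≃ {χ : B →ₐ[A] F // χ h ≠ 0}) := by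
  let e : Localization.Away h ⊗[A] F ≃+* Localization.Away ((1 : F) ⊗ₜ[A] h) :=
    (Algebra.TensorProduct.comm A (Localization.Away h) F).toRingEquiv.trans
      (IsLocalization.Away.tensorProductEquivTMulRight A F h (Localization.Away h)).toRingEquiv
  obtain ⟨e₁⟩ := nonempty_primeSpectrum_localizationAway_equiv ((1 : F) ⊗ₜ[A] h)
  obtain ⟨e₂⟩ := nonempty_primeSpectrum_equiv_algHom (F := F) ((1 : F) ⊗ₜ[A] h)
  obtain ⟨e₃⟩ := nonempty_algHom_baseChange_equiv (A := A) (K := F) (F := F) h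
  exact ⟨(PrimeSpectrum.comapEquiv e).toEquiv.trans (e₁.trans (e₂.symm.trans e₃.symm))⟩

end GeometricPoints

/-! ### The Hermite matrix and its specialisations. -/

section HermiteMatrix

open TensorProduct QuadraticForm

/-- The matrix of the form `Tr (h² x²)` in a basis. -/
noncomputable def hermiteMatrix {K C ι : Type*} [CommRing K] [CommRing C] [Algebra K C]
    (b : Module.Basis ι K C) (h : C) : Matrix ι ι K :=
  Matrix.of fun i j => Algebra.trace K C (h ^ 2 * (b i * b j))

theorem hermiteMatrix_isSymm {K C ι : Type*} [CommRing K] [CommRing C] [Algebra K C]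
    (b : Module.Basis ι K C) (h : C) : (hermiteMatrix b h).IsSymm := by
  ext i j
  simp [hermiteMatrix, mul_comm (b i)]

theorem hermiteForm_equivalent {K C ι : Type*} [CommRing K] [CommRing C] [Algebra K C]
    [Fintype ι] [DecidableEq ι] (b : Module.Basis ι K C) (h : C) :
    QuadraticMap.Equivalent (hermiteForm K h) (hermiteMatrix b h).toQuadraticForm' := by
  refine ⟨⟨b.equivFun, fun x => ?_⟩⟩
  have hM : hermiteMatrix b h = LinearMap.BilinForm.toMatrix b (hermiteBilin K h) := by
    ext i j
    simp [hermiteMatrix, hermiteBilin_apply]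
  have := LinearMap.BilinForm.apply_eq_dotProduct_toMatrix_mulVec b (hermiteBilin K h) x x
  simp only [Matrix.toQuadraticForm', hermiteForm, LinearMap.BilinMap.toQuadraticMap_apply,
    Matrix.toLinearMap₂'_apply']
  rw [this, hM]
  rfl

/-- Traces of free modules commute with base change, so one matrix over `A` governs all fibers. -/
theorem hermiteMatrix_baseChange {A B K ι : Type*} [CommRing A] [CommRing B] [Algebra A B]
    [Module.Finite A B] [Module.Free A B] [CommRing K] [Algebra A K] (b : Module.Basis ι A B)
    (h : B) :
    hermiteMatrix (Algebra.TensorProduct.basis K b) ((1 : K) ⊗ₜ[A] h) =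
      (hermiteMatrix b h).map (algebraMap A K) := by
  ext i j
  simp only [hermiteMatrix, Matrix.of_apply, Matrix.map_apply, Algebra.TensorProduct.basis_apply,
    Algebra.TensorProduct.tmul_mul_tmul, Algebra.TensorProduct.tmul_pow, one_pow, mul_one,
    Algebra.trace_apply]
  rw [← Algebra.baseChange_lmul, LinearMap.trace_baseChange]

/-- Finiteness is what lets `Nat.card` in Hermite's theorem be read as a cardinal. -/
theorem finite_algHom_ne_zero {K C F : Type*} [Field K] [CommRing C] [Algebra K C]
    [FiniteDimensional K C] [Field F] [Algebra K F] (h : C) :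
    Finite {χ : C →ₐ[K] F // χ h ≠ 0} := by
  have : IsArtinianRing C := IsArtinianRing.of_finite K C
  have hfin : ∀ m : MaximalSpectrum C, Finite (C ⧸ m.asIdeal →ₐ[K] F) := fun m =>
    have := m.isMaximal
    let := Ideal.Quotient.field m.asIdeal
    inferInstance
  exact Finite.of_equiv _ (sigmaMaximalSpectrumEquivAlgHom h F)

/-- Rank and signature of the Hermite matrix at a rational point `y` count the geometric and the
rational points of `D(h)` above `y`. -/
theorem sigPos_hermiteMatrix_rationalPointEval {R A B ι : Type*} [Field R] [LinearOrder R]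
    [IsStrictOrderedRing R] [IsRealClosed R] [CommRing A] [CommRing B] [Algebra R A]
    [Algebra R B] [Algebra A B] [IsScalarTower R A B] [Module.Finite A B] [Module.Free A B]
    [Fintype ι] [DecidableEq ι] (b : Module.Basis ι A B) (h : B) (y : rationalPoints R A) :
    ∃ N s : ℕ, Cardinal.mk (GeometricFiber A h y.1) = N ∧
      Cardinal.mk {x : rationalPoints R B |
        rationalPointsMap R A B x = y ∧ x.1 ∈ PrimeSpectrum.basicOpen h} = s ∧
      sigPos ((hermiteMatrix b h).map (rationalPointEval y)).toQuadraticForm' +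
        sigNeg ((hermiteMatrix b h).map (rationalPointEval y)).toQuadraticForm' = N ∧
      sigPos ((hermiteMatrix b h).map (rationalPointEval y)).toQuadraticForm' =
        sigNeg ((hermiteMatrix b h).map (rationalPointEval y)).toQuadraticForm' + s := by
  -- Evaluation at y makes `R` an `A`-algebra; the fiber is then the finite `R`-algebra R ⊗[A] B.
  let : Algebra A R := (rationalPointEval y).toRingHom.toAlgebra
  have hy : ∀ a, algebraMap A R a = rationalPointEval y a := fun a => rfl
  let F := AlgebraicClosure y.1.asIdeal.ResidueField
  have : IsScalarTower A R F := .of_algebraMap_eq fun a => by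
    rw [IsScalarTower.algebraMap_apply A y.1.asIdeal.ResidueField F,
      IsScalarTower.algebraMap_apply R y.1.asIdeal.ResidueField F, hy,
      algebraMap_rationalPointEval]
  obtain ⟨e₁⟩ := nonempty_primeSpectrum_localization_tensorProduct_equiv (A := A) (F := F) h
  obtain ⟨e₂⟩ := nonempty_algHom_baseChange_equiv (A := A) (K := R) (F := F) h
  obtain ⟨e₃⟩ := nonempty_rationalPoints_fiber_equiv h y hy
  obtain ⟨e₄⟩ := nonempty_algHom_baseChange_equiv (A := A) (K := R) (F := R) h
  have hF := finite_algHom_ne_zero (F := F) ((1 : R) ⊗ₜ[A] h) (K := R)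
  have hR := finite_algHom_ne_zero (F := R) ((1 : R) ⊗ₜ[A] h) (K := R)
  obtain ⟨h1, h2⟩ := sigPos_hermiteForm (R := R) ((1 : R) ⊗ₜ[A] h) F
  have heq := hermiteForm_equivalent (Algebra.TensorProduct.basis R b) ((1 : R) ⊗ₜ[A] h)
  rw [hermiteMatrix_baseChange] at heq
  rw [heq.sigPos_eq, heq.sigNeg_eq] at h1 h2
  have := Finite.of_equiv _ (e₁.trans e₂).symm
  have := Finite.of_equiv _ (e₃.trans e₄).symm
  refine ⟨_, _, ?_, ?_, h1, h2⟩
  · rw [← Nat.card_congr (e₁.trans e₂), Nat.cast_card]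
  · rw [← Nat.card_congr (e₃.trans e₄), Nat.cast_card]

end HermiteMatrix

/-! ### Constancy of the index on connected sets. -/

section Constancy

open QuadraticForm MvPolynomial

/-- A drop of the index below its value k at `x` would split `S` into {p ≥ k} and {p < k}, both
closed in `S` because p and N - p are lower semicontinuous there. -/
theorem sigPos_le_of_isSemialgebraicallyConnected {R ι : Type*} [Field R] [LinearOrder R]
    [IsStrictOrderedRing R] [IsRealClosed R] [Fintype ι] [DecidableEq ι] {n : ℕ}
    {S : Set (Fin n → R)} (hS : IsSemialgebraic S) (hSconn : IsSemialgebraicallyConnected S)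
    {M : Matrix ι ι (MvPolynomial (Fin n) R)} (hM : M.IsSymm) {N : ℕ}
    (hN : ∀ x ∈ S, sigPos (M.map (eval x)).toQuadraticForm' +
      sigNeg (M.map (eval x)).toQuadraticForm' = N) {x x' : Fin n → R} (hx : x ∈ S)
    (hx' : x' ∈ S) :
    sigPos (M.map (eval x)).toQuadraticForm' ≤ sigPos (M.map (eval x')).toQuadraticForm' := by
  let _ : TopologicalSpace R := Preorder.topology R
  have : OrderTopology R := ⟨rfl⟩
  let Q : (Fin n → R) → QuadraticForm R (ι → R) := fun z => (M.map (eval z)).toQuadraticForm'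
  have hQ : ∀ v, Continuous fun z => Q z v := by
    intro v
    have hval : ∀ z, Q z v = ∑ i, v i * ∑ j, eval z (M i j) * v j := fun z => by
      simp only [Q, Matrix.toQuadraticForm', LinearMap.BilinMap.toQuadraticMap_apply,
        Matrix.toLinearMap₂'_apply']
      rfl
    simp only [hval]
    exact continuous_finsetSum _ fun i _ => continuous_const.mul
      (continuous_finsetSum _ fun j _ => (MvPolynomial.continuous_eval _).mul continuous_const)
  have hQneg : ∀ v, Continuous fun z => (-Q z) v := fun v => (hQ v).neg
  obtain ⟨F, hF⟩ := exists_finset_sign_congruent M hM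
  by_contra! hlt
  set k := sigPos (Q x) with hk
  have hkN : k ≤ N := by rw [← hN x hx]; exact Nat.le_add_right _ _
  -- Since the indices add up to N, p ≥ k means that the negative index is at most N - k; `hkN`
  -- keeps the natural subtraction honest.
  have hiff : ∀ z ∈ S, (k ≤ sigPos (Q z) ↔ ¬ N + 1 - k ≤ sigPos (-Q z)) := by
    intro z hz
    have := hN z hz
    rw [sigPos_neg]
    change sigPos (Q z) + sigNeg (Q z) = N at this
    omega
  refine hSconn ⟨{z ∈ S | k ≤ sigPos (Q z)}, {z ∈ S | ¬ k ≤ sigPos (Q z)}, ⟨x, hx, hk.le⟩,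
    ⟨x', hx', not_le.mpr hlt⟩, ?_, ?_, ?_, ?_, ?_, ?_⟩
  · refine hS.of_sign (Set.sep_subset _ _) F fun z hz z' hz' hsign => ⟨hz', ?_⟩
    rw [← (hF z z' hsign).equivalent.sigPos_eq]
    exact hz.2
  · refine hS.of_sign (Set.sep_subset _ _) F fun z hz z' hz' hsign => ⟨hz', ?_⟩
    rw [← (hF z z' hsign).equivalent.sigPos_eq]
    exact hz.2
  · refine ⟨{z | N + 1 - k ≤ sigPos (-Q z)}ᶜ, ?_, ?_⟩
    · exact (@isClosed_compl_iff _ (euclideanTopology R n) _).mpr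
        (isOpen_euclideanTopology_of_pi (isOpen_setOf_le_sigPos _ hQneg _))
    · ext z
      exact ⟨fun hz => ⟨(hiff z hz.1).mp hz.2, hz.1⟩, fun hz => ⟨hz.2, (hiff z hz.2).mpr hz.1⟩⟩
  · refine ⟨{z | k ≤ sigPos (Q z)}ᶜ, ?_, ?_⟩
    · exact (@isClosed_compl_iff _ (euclideanTopology R n) _).mpr
        (isOpen_euclideanTopology_of_pi (isOpen_setOf_le_sigPos _ hQ _))
    · ext z
      exact and_comm
  · exact Set.disjoint_left.mpr fun z hz hz' => hz'.2 hz.2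
  · ext z
    exact ⟨fun hz => hz.elim And.left And.left, fun hz => (em _).imp (⟨hz, ·⟩) (⟨hz, ·⟩)⟩

end Constancy

/-! ### The main theorem. -/

theorem mainTheorem1 {R A B : Type*} [Field R] [LinearOrder R] [IsStrictOrderedRing R]
    [IsRealClosed R]
    [CommRing A] [CommRing B] [Algebra R A] [Algebra R B] [Algebra A B] [IsScalarTower R A B]
    [Algebra.FiniteType R A] [Algebra.FiniteType R B]
    [Module.Finite A B] [Module.Free A B]
    (hdom : DenseRange (PrimeSpectrum.comap (algebraMap A B)))
    (h : B)
    {n : ℕ} (φ : MvPolynomial (Fin n) R →ₐ[R] A) (hφ : Function.Surjective φ)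
    (S : Set (rationalPoints R A))
    (hS : IsSemialgebraic (rationalPointCoords φ '' S))
    (hSconn : IsSemialgebraicallyConnected (rationalPointCoords φ '' S))
    (hgeom : ∀ y ∈ S, ∀ y' ∈ S,
      Cardinal.mk (GeometricFiber A h y.1) = Cardinal.mk (GeometricFiber A h y'.1)) :
    ∀ y ∈ S, ∀ y' ∈ S,
      Cardinal.mk {x : rationalPoints R B |
          rationalPointsMap R A B x = y ∧ x.1 ∈ PrimeSpectrum.basicOpen h} =
        Cardinal.mk {x : rationalPoints R B |
          rationalPointsMap R A B x = y' ∧ x.1 ∈ PrimeSpectrum.basicOpen h} := by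
  classical
  intro y hy y' hy'
  let b := Module.Free.chooseBasis A B
  -- Lift the entries to polynomials on the ambient affine space. Using one section for all entries
  -- gives equal entries equal lifts, so symmetry survives.
  let M := (hermiteMatrix b h).map (Function.surjInv hφ)
  have hM : M.IsSymm := (hermiteMatrix_isSymm b h).map _
  have hMeval : ∀ z : rationalPoints R A, M.map (MvPolynomial.eval (rationalPointCoords φ z)) =
      (hermiteMatrix b h).map (rationalPointEval z) := by
    intro z
    ext i j
    simp only [M, Matrix.map_apply, eval_rationalPointCoords, Function.surjInv_eq]
  obtain ⟨N, s, hN, hs, h1, h2⟩ := sigPos_hermiteMatrix_rationalPointEval b h y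
  obtain ⟨N', s', hN', hs', h1', h2'⟩ := sigPos_hermiteMatrix_rationalPointEval b h y'
  have hrank : ∀ x ∈ rationalPointCoords φ '' S,
      sigPos (M.map (MvPolynomial.eval x)).toQuadraticForm' +
        sigNeg (M.map (MvPolynomial.eval x)).toQuadraticForm' = N := by
    rintro _ ⟨z, hz, rfl⟩
    obtain ⟨L, _, hL, -, h3, -⟩ := sigPos_hermiteMatrix_rationalPointEval b h z
    rw [hMeval, h3]
    exact_mod_cast hL.symm.trans ((hgeom z hz y hy).trans hN)
  have hle := fun {x x'} => sigPos_le_of_isSemialgebraicallyConnected hS hSconn hM hrank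
    (x := x) (x' := x')
  have heq := le_antisymm (hle ⟨y, hy, rfl⟩ ⟨y', hy', rfl⟩) (hle ⟨y', hy', rfl⟩ ⟨y, hy, rfl⟩)
  rw [hMeval, hMeval] at heq
  have hNN' : N = N' := by exact_mod_cast hN.symm.trans ((hgeom y hy y' hy').trans hN')
  rw [hs, hs', show s = s' by omega]
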